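/- **Setting.** Let $0\le t\le T$ with $T>0$, and for a metric space $E$ with its Borel $\sigma$-algebra let $\mathcal P_2(E)$ be the set of probability measures on $E$ with finite second moment, with the 2-Wasserstein distance $\mathcal W_2$; write $\mathcal P_2=\mathcal P_2(\mathbb R^d\times\mathbb R^l)$. Let $b,\sigma,f,c$ be functions on $[0,T]\times\mathcal P_2\times\mathbb R^d\times\mathbb R^l$ with values in $\mathbb R^d$, $\mathbb R^{d\times q}$, $\mathbb R$ and $\mathbb R^{1\times l}$, let $\gamma:[0,T]\to\mathbb R^{d\times l}$ and $g:\mathcal P_2\times\mathbb R^d\times\mathbb R^l\to\mathbb R$, and assume: $b,\sigma$ are continuous in time and Lipschitz in $(m,x,\xi)$ uniformly in time; $\gamma$ and $g$ are continuous; $f$ and $c$ are locally uniformly continuous; $c$ is of linear growth in $(x,\xi)$, and $f,g$ are of quadratic growth in $(x,\xi)$, locally uniformly in $m$ and uniformly in time. $D^0([a,b])$ denotes the space of càdlàg paths on $[a-,b]$ with values in $\mathbb R^d\times\mathbb R^l$ (a càdlàg path on $[a,b]$ together with a value at $a-$). "Non-decreasing" is meant componentwise. *Admissible controls.* For $m_0\in\mathcal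 P_2$, an admissible control $\mathbb P\in\mathcal P(t,m_0)$ is a law in $\mathcal P_2(D^0([t,T]))$ of a pair $(X,\xi)$ such that $(X_{t-},\xi_{t-})$ has law $m_0$, $\xi$ is a.s. non-decreasing on $[t-,T]$, and $\mathbb P$ is the marginal law of a weak solution $(X,\xi,W)$ of $$dX_u=b(u,m_u,X_u,\xi_u)\,du+\sigma(u,m_u,X_u,\xi_u)\,dW_u+\gamma(u)\,d\xi_u,\qquad m_u=\mathrm{Law}(X_u,\xi_u),$$ on $[t-,T]$ (with $X_t=X_{t-}+\gamma(t)(\xi_t-\xi_{t-})$), where $W$ is a $q$-dimensional Brownian motion for the filtration generated by $(X,\xi,W)$. *Two-layer parametrisations.* Let $\hat r\in C([0,1];[t,T])$, $\hat m\in C([0,1];\mathcal P_2)$ and $\bar{\mathbb P}\in\mathcal P_2(C([0,1];\mathbb R^d\times\mathbb R^l\times[0,1]))$; write $(\bar X,\bar\xi,\bar s)$ for the canonical process under $\bar{\mathbb P}$, $r_v=\inf\{u\in[0,1]:\hat r_u>v\}\wedge1$ and $s_v=\inf\{u\in[0,1]:\bar s_u>v\}\wedge1$ for the right-continuous inverses,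 and $(\hat X_u,\hat\xi_u)=(\bar X_{s_u},\bar\xi_{s_u})$ for $u\in[0,1]$, $(\hat X_{0-},\hat\xi_{0-})=(\bar X_0,\bar\xi_0)$. Then $((\hat m,\hat r),\bar{\mathbb P})$ is a two-layer parametrisation of $\mathbb P$ if 1. the law $\hat{\mathbb P}$ of $(\hat X,\hat\xi)$ and $\hat r$ form a $\mathcal P_2$-parametrisation of $\mathbb P$: $\hat{\mathbb P}\in\mathcal P_2(D^0([0,1]))$, the process $(\hat X_{r_u},\hat\xi_{r_u})_{u\in[t-,T]}$ (with value $(\hat X_{0-},\hat\xi_{0-})$ at $t-$) has law $\mathbb P$, $\hat\xi$ is a.s. non-decreasing on $[0-,1]$, the flow $u\mapsto\mathrm{Law}(\hat X_u,\hat\xi_u)$ is continuous on $[0-,1]$, and $\hat{\mathbb P}$ is the marginal law of a weak solution $(\hat X,\hat\xi,\hat W)$ of $$d\hat X_u=b(\hat r_u,\hat m_u,\hat X_u,\hat\xi_u)\,d\hat r_u+\sigma(\hat r_u,\hat m_u,\hat X_u,\hat\xi_u)\,d\hat W_{\hat r_u}+\gamma(\hat r_u)\,d\hat\xi_u$$ on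 $[0-,1]$ (with $\hat X_0=\hat X_{0-}+\gamma(\hat r_0)(\hat\xi_0-\hat\xi_{0-})$), where $\hat m_u=\mathrm{Law}(\hat X_u,\hat\xi_u)$, $\hat r$ is non-decreasing with $\hat r_0=t$, $\hat r_1=T$, and $\hat W$ is a Brownian motion on $[t,T]$ for the filtration $\mathcal F^{\hat W}_u\vee\mathcal F^{\hat X,\hat\xi}_{r_u}$; 2. $\hat m_u$ is the law of $(\hat X_u,\hat\xi_u)$ for all $u\in[0-,1]$ (with $\hat m_{0-}=\hat m_0$); 3. $\bar\xi$ is a.s. non-decreasing; 4. $\bar{\mathbb P}$ is the marginal law of a weak solution $(\bar X,\bar\xi,\bar s,\bar W)$, with law of finite second moment, of $$d\bar X_u=b(\hat r_{\bar s_u},\hat m_{\bar s_u},\bar X_u,\bar\xi_u)\,d\hat r_{\bar s_u}+\sigma(\hat r_{\bar s_u},\hat m_{\bar s_u},\bar X_u,\bar\xi_u)\,d\bar W_{\hat r_{\bar s_u}}+\gamma(\hat r_{\bar s_u})\,d\bar\xi_u$$ on $[0,1]$, where a.s. $\bar s$ is non-decreasing with $\bar s_0=0$, $\bar s_1=1$,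 and $\bar W$ is a Brownian motion on $[t,T]$ for the filtration $\mathcal F^{\bar W}_u\vee\mathcal F^{\bar X,\bar\xi,\bar s}_{s_{r_u}}$, the second $\sigma$-algebra being generated by the process stopped at $s_{r_u}$. A two-layer parametrisation on $[t,T]$ is a tuple that is a two-layer parametrisation of some $\mathbb P\in\mathcal P(t,m_0)$ for some $m_0\in\mathcal P_2$. A sequence $((\hat m^n,\hat r^n),\bar{\mathbb P}^n)$ of two-layer parametrisations converges to the two-layer parametrisation $((\hat m,\hat r),\bar{\mathbb P})$ if $(\hat m^n,\hat r^n)\to(\hat m,\hat r)$ uniformly, that is in $C([0,1];\mathcal P_2\times[t,T])$, and $\bar{\mathbb P}^n\to\bar{\mathbb P}$ in $\mathcal P_2(C([0,1];\mathbb R^d\times\mathbb R^l\times[0,1]))$. **Lemma.** For every two-layer parametrisation the random variable in the definition of the reward $$J((\hat m,\hat r),\bar{\mathbb P})=\mathbb E^{\bar{\mathbb P}}\Big[\int_0^1 f(\hat r_{\bar s_u},\hat m_{\bar s_u},\bar X_u,\bar\xi_u)\,d\hat r_{\bar s_u}+g(\hat m_{\bar s_1},\bar X_1,\bar\xi_1)-\int_0^1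 c(\hat r_{\bar s_u},\hat m_{\bar s_u},\bar X_u,\bar\xi_u)\,d\bar\xi_u\Big]$$ is $\bar{\mathbb P}$-integrable, and $J$ is continuous with respect to convergence of two-layer parametrisations: if $((\hat m^n,\hat r^n),\bar{\mathbb P}^n)\to((\hat m,\hat r),\bar{\mathbb P})$, then $J((\hat m^n,\hat r^n),\bar{\mathbb P}^n)\to J((\hat m,\hat r),\bar{\mathbb P})$. -/

import Mathlib

open Set Filter Topology MeasureTheory ProbabilityTheory
open scoped ENNReal NNReal

noncomputable section

/-! ### The Wasserstein space of order two -/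

/-- `C(X, Y)` carries the Borel `σ`-algebra of the compact-open topology. -/
instance instMeasurableSpaceContinuousMap {X Y : Type*} [TopologicalSpace X]
    [TopologicalSpace Y] : MeasurableSpace C(X, Y) := borel _

instance instBorelSpaceContinuousMap {X Y : Type*} [TopologicalSpace X]
    [TopologicalSpace Y] : BorelSpace C(X, Y) := ⟨rfl⟩

/-- The measure `μ` has a finite second moment. -/
def HasFiniteSecondMoment {E : Type*} [PseudoEMetricSpace E] [MeasurableSpace E]
    (μ : Measure E) : Prop :=
  ∀ x₀ : E, ∫⁻ x, edist x x₀ ^ 2 ∂μ < ∞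

/-- `𝒫₂(E)`: the probability measures on `E` with a finite second moment. -/
structure P2 (E : Type*) [PseudoEMetricSpace E] [MeasurableSpace E] where
  toMeasure : Measure E
  isProbabilityMeasure : IsProbabilityMeasure toMeasure
  secondMoment : HasFiniteSecondMoment toMeasure

/-- `π` is a coupling of `μ` and `ν`. -/
def IsCoupling {E : Type*} [MeasurableSpace E] (μ ν : Measure E) (π : Measure (E × E)) : Prop :=
  π.map Prod.fst = μ ∧ π.map Prod.snd = ν

/-- The `L²`-transport cost `(∫ d(x, y)² π(dx, dy))^{1/2}` of a coupling `π`. -/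
def transportCost {E : Type*} [PseudoEMetricSpace E] [MeasurableSpace E]
    (π : Measure (E × E)) : ℝ≥0∞ :=
  (∫⁻ p, edist p.1 p.2 ^ (2 : ℝ) ∂π) ^ (1 / (2 : ℝ))

/-- The 2-Wasserstein distance: the infimum of the transport costs over all couplings. -/
def wasserstein2 {E : Type*} [PseudoEMetricSpace E] [MeasurableSpace E]
    (μ ν : Measure E) : ℝ≥0∞ :=
  ⨅ (π : Measure (E × E)) (_ : IsCoupling μ ν π), transportCost π

theorem wasserstein2_self {E : Type*} [PseudoEMetricSpace E] [SecondCountableTopology E]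
    [MeasurableSpace E] [BorelSpace E] (μ : Measure E) : wasserstein2 μ μ = 0 := by
  have hm : Measurable fun x : E => (x, x) := measurable_id.prodMk measurable_id
  refine le_antisymm (iInf₂_le_of_le (μ.map fun x => (x, x)) ⟨?_, ?_⟩ ?_) zero_le
  · rw [Measure.map_map measurable_fst hm]; exact Measure.map_id
  · rw [Measure.map_map measurable_snd hm]; exact Measure.map_id
  · unfold transportCost
    rw [lintegral_map (by fun_prop) hm]
    simp

theorem wasserstein2_comm_le {E : Type*} [PseudoEMetricSpace E] [SecondCountableTopology E]
    [MeasurableSpace E] [BorelSpace E] (μ ν : Measure E) :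
    wasserstein2 μ ν ≤ wasserstein2 ν μ := by
  refine le_iInf₂ fun π hπ => iInf₂_le_of_le (π.map Prod.swap) ⟨?_, ?_⟩ (le_of_eq ?_)
  · rw [Measure.map_map measurable_fst measurable_swap]; exact hπ.2
  · rw [Measure.map_map measurable_snd measurable_swap]; exact hπ.1
  · unfold transportCost
    rw [lintegral_map (by fun_prop) measurable_swap]
    simp [edist_comm]

/-- The triangle inequality, by gluing couplings along the common marginal. -/
theorem wasserstein2_triangle {E : Type*} [PseudoEMetricSpace E] [SecondCountableTopology E]
    [MeasurableSpace E] [BorelSpace E] [StandardBorelSpace E] (μ ν ρ : Measure E)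
    [IsProbabilityMeasure μ] [IsProbabilityMeasure ν] :
    wasserstein2 μ ρ ≤ wasserstein2 μ ν + wasserstein2 ν ρ := by
  have key : ∀ π₁ π₂ : Measure (E × E), IsCoupling μ ν π₁ → IsCoupling ν ρ π₂ →
      wasserstein2 μ ρ ≤ transportCost π₁ + transportCost π₂ := by
    intro π₁ π₂ h₁ h₂
    have : Nonempty E := by
      by_contra hE
      rw [not_nonempty_iff] at hE
      have := measure_univ (μ := ν)
      simp [Set.univ_eq_empty_iff.2 hE] at this
    have i₁ : IsProbabilityMeasure π₁ := by
      have h : IsProbabilityMeasure (π₁.map Prod.fst) := by rw [h₁.1]; infer_instance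
      exact Measure.isProbabilityMeasure_of_map Prod.fst
    have i₂ : IsProbabilityMeasure π₂ := by
      have h : IsProbabilityMeasure (π₂.map Prod.fst) := by rw [h₂.1]; infer_instance
      exact Measure.isProbabilityMeasure_of_map Prod.fst
    let κ : Kernel (E × E) E := π₂.condKernel.comap Prod.snd measurable_snd
    let θ : Measure ((E × E) × E) := π₁.compProd κ
    have hθ₁ : θ.map Prod.fst = π₁ := Measure.fst_compProd π₁ κ
    have hθ₂ : θ.map (fun p => (p.1.2, p.2)) = π₂ := by
      have hmeas : Measurable fun p : (E × E) × E => (p.1.2, p.2) := by fun_prop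
      have hdis : (π₂.map Prod.fst).compProd π₂.condKernel = π₂ := π₂.disintegrate π₂.condKernel
      conv_rhs => rw [← hdis, h₂.1, ← h₁.2]
      ext s hs
      rw [Measure.map_apply hmeas hs, Measure.compProd_apply (hmeas hs),
        Measure.compProd_apply hs, lintegral_map (Kernel.measurable_kernel_prodMk_left hs)
          measurable_snd]
      rfl
    refine iInf₂_le_of_le (θ.map fun p => (p.1.1, p.2)) ⟨?_, ?_⟩ ?_
    · rw [Measure.map_map measurable_fst (by fun_prop), ← h₁.1, ← hθ₁,
        Measure.map_map measurable_fst measurable_fst]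
      rfl
    · rw [Measure.map_map measurable_snd (by fun_prop), ← h₂.2, ← hθ₂,
        Measure.map_map measurable_snd (by fun_prop)]
      rfl
    · have e₁ : transportCost π₁ =
          (∫⁻ p, edist p.1.1 p.1.2 ^ (2 : ℝ) ∂θ) ^ (1 / (2 : ℝ)) := by
        conv_lhs => rw [← hθ₁]
        unfold transportCost
        rw [lintegral_map (by fun_prop) measurable_fst]
      have e₂ : transportCost π₂ =
          (∫⁻ p, edist p.1.2 p.2 ^ (2 : ℝ) ∂θ) ^ (1 / (2 : ℝ)) := by
        conv_lhs => rw [← hθ₂]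
        unfold transportCost
        rw [lintegral_map (by fun_prop) (by fun_prop)]
      rw [e₁, e₂]
      unfold transportCost
      rw [lintegral_map (by fun_prop) (by fun_prop)]
      refine le_trans ?_ (ENNReal.lintegral_Lp_add_le (p := 2) (by fun_prop) (by fun_prop)
        (by norm_num))
      gcongr with p
      exact edist_triangle _ _ _
  conv_rhs => unfold wasserstein2
  simp only [ENNReal.iInf_add, ENNReal.add_iInf]
  exact le_iInf fun π₂ => le_iInf fun h₂ => le_iInf fun π₁ => le_iInf fun h₁ => key π₁ π₂ h₁ h₂

/-- `𝒫₂(E)` is equipped with the 2-Wasserstein distance, and with the topology and the uniform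
structure of this distance. -/
instance instPseudoEMetricSpaceP2 {E : Type*} [PseudoEMetricSpace E] [SecondCountableTopology E]
    [MeasurableSpace E] [BorelSpace E] [StandardBorelSpace E] : PseudoEMetricSpace (P2 E) where
  edist μ ν := wasserstein2 μ.toMeasure ν.toMeasure
  edist_self μ := wasserstein2_self μ.toMeasure
  edist_comm μ ν := le_antisymm (wasserstein2_comm_le _ _) (wasserstein2_comm_le _ _)
  edist_triangle μ ν ρ := by
    have := μ.isProbabilityMeasure
    have := ν.isProbabilityMeasure
    exact wasserstein2_triangle _ _ _

/-! ### The coefficients of the control problem -/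

/-- `ℝⁿ` with the Euclidean norm. -/
abbrev Vec (n : ℕ) : Type := EuclideanSpace ℝ (Fin n)

/-- `ℝᵈ × ℝˡ`, the space of the values of the pair (state, control). -/
abbrev StateControl (d l : ℕ) : Type := Vec d × Vec l

/-- The coefficients `b, σ, γ` of the state equation with a `q`-dimensional Brownian motion, and the
reward and cost functions `f, g, c`. Matrices are written as linear maps, and the row vector `c` as
the vector of its components. Only the values at times in `[0, T]` matter. -/
structure Coefficients (d l q : ℕ) where
  b : ℝ → P2 (StateControl d l) → Vec d → Vec l → Vec d
  σ : ℝ → P2 (StateControl d l) → Vec d → Vec l → (Vec q →L[ℝ] Vec d)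
  γ : ℝ → (Vec l →L[ℝ] Vec d)
  f : ℝ → P2 (StateControl d l) → Vec d → Vec l → ℝ
  g : P2 (StateControl d l) → Vec d → Vec l → ℝ
  c : ℝ → P2 (StateControl d l) → Vec d → Vec l → Vec l

/-- `h` is locally uniformly continuous on `D`: every point of `D` has a neighbourhood in `D` on
which `h` is uniformly continuous. -/
def LocallyUniformContinuousOn {A B : Type*} [UniformSpace A] [UniformSpace B]
    (h : A → B) (D : Set A) : Prop :=
  ∀ p ∈ D, ∃ U ∈ 𝓝[D] p, UniformContinuousOn h U

/-- The standing assumptions on the coefficients, with time horizon `T`. -/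
structure StandingAssumptions {d l q : ℕ} (M : Coefficients d l q) (T : ℝ) : Prop where
  b_continuous : ∀ m x ξ, ContinuousOn (fun s => M.b s m x ξ) (Icc 0 T)
  σ_continuous : ∀ m x ξ, ContinuousOn (fun s => M.σ s m x ξ) (Icc 0 T)
  b_lipschitz : ∃ L : ℝ≥0, ∀ s ∈ Icc 0 T, LipschitzWith L
    fun p : P2 (StateControl d l) × Vec d × Vec l => M.b s p.1 p.2.1 p.2.2
  σ_lipschitz : ∃ L : ℝ≥0, ∀ s ∈ Icc 0 T, LipschitzWith L
    fun p : P2 (StateControl d l) × Vec d × Vec l => M.σ s p.1 p.2.1 p.2.2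
  γ_continuous : ContinuousOn M.γ (Icc 0 T)
  f_continuous : LocallyUniformContinuousOn
    (fun p : ℝ × P2 (StateControl d l) × Vec d × Vec l => M.f p.1 p.2.1 p.2.2.1 p.2.2.2)
    (Icc 0 T ×ˢ univ)
  c_continuous : LocallyUniformContinuousOn
    (fun p : ℝ × P2 (StateControl d l) × Vec d × Vec l => M.c p.1 p.2.1 p.2.2.1 p.2.2.2)
    (Icc 0 T ×ˢ univ)
  g_continuous : Continuous
    fun p : P2 (StateControl d l) × Vec d × Vec l => M.g p.1 p.2.1 p.2.2
  c_growth : ∀ m₀ : P2 (StateControl d l), ∃ U ∈ 𝓝 m₀, ∃ K : ℝ, ∀ s ∈ Icc 0 T, ∀ m ∈ U,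
    ∀ x ξ, ‖M.c s m x ξ‖ ≤ K * (1 + ‖x‖ + ‖ξ‖)
  f_growth : ∀ m₀ : P2 (StateControl d l), ∃ U ∈ 𝓝 m₀, ∃ K : ℝ, ∀ s ∈ Icc 0 T, ∀ m ∈ U,
    ∀ x ξ, |M.f s m x ξ| ≤ K * (1 + ‖x‖ ^ 2 + ‖ξ‖ ^ 2)
  g_growth : ∀ m₀ : P2 (StateControl d l), ∃ U ∈ 𝓝 m₀, ∃ K : ℝ, ∀ m ∈ U,
    ∀ x ξ, |M.g m x ξ| ≤ K * (1 + ‖x‖ ^ 2 + ‖ξ‖ ^ 2)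

/-! ### Path spaces and time changes -/

/-- The space `D⁰([a, b]; E)` of càdlàg paths on `[a-, b]`: a càdlàg path on `[a, b]` together with
a value `pre` at time `a-`. -/
structure CadlagPath (a b : ℝ) (E : Type*) [TopologicalSpace E] where
  pre : E
  toFun : Icc a b → E
  right_continuous : ∀ u, ContinuousWithinAt toFun (Ici u) u
  left_limit : ∀ u, ∃ y, Tendsto toFun (𝓝[<] u) (𝓝 y)

/-- The `σ`-algebra generated by the evaluations, which is the Borel `σ`-algebra of the Skorokhod
topologies on the path space (in particular of the weak `M₁` topology). -/
instance instMeasurableSpaceCadlagPath {a b : ℝ} {E : Type*} [TopologicalSpace E]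
    [MeasurableSpace E] : MeasurableSpace (CadlagPath a b E) :=
  MeasurableSpace.comap CadlagPath.pre inferInstance ⊔
    ⨆ u, MeasurableSpace.comap (fun y : CadlagPath a b E => y.toFun u) inferInstance

/-- The supremum norm of a càdlàg path on `[a-, b]`. -/
def CadlagPath.supNorm {a b : ℝ} {E : Type*} [NormedAddCommGroup E] (y : CadlagPath a b E) :
    ℝ≥0∞ :=
  max ‖y.pre‖ₑ (⨆ u, ‖y.toFun u‖ₑ)

/-- The composition `y ∘ τ` of a càdlàg path with a non-decreasing right-continuous time change;
the value before the initial time is kept. -/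
def CadlagPath.timeChange {a b a' b' : ℝ} {E : Type*} [TopologicalSpace E]
    (y : CadlagPath a b E) (τ : Icc a' b' → Icc a b) (hmono : Monotone τ)
    (hright : ∀ u, ContinuousWithinAt τ (Ici u) u) : CadlagPath a' b' E where
  pre := y.pre
  toFun := fun u => y.toFun (τ u)
  right_continuous := fun u =>
    (y.right_continuous (τ u)).comp (hright u) fun _ hv => hmono hv
  left_limit := fun u => by
    by_cases hne : (Iio u).Nonempty
    · have hlub : ∃ w, IsLUB (τ '' Iio u) w := by
        obtain ⟨v, hv⟩ := hne
        have : Fact (a ≤ b) := ⟨(τ v).2.1.trans (τ v).2.2⟩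
        exact ⟨_, isLUB_sSup _⟩
      obtain ⟨w, hw⟩ := hlub
      have hconv : Tendsto τ (𝓝[<] u) (𝓝 w) := by
        refine tendsto_order.2 ⟨fun w' hw' => ?_, fun w' hw' => ?_⟩
        · obtain ⟨_, ⟨v, hv, rfl⟩, h⟩ := (lt_isLUB_iff hw).1 hw'
          filter_upwards [Ioo_mem_nhdsLT hv] with x hx using h.trans_le (hmono hx.1.le)
        · filter_upwards [self_mem_nhdsWithin] with x hx
          exact (hw.1 ⟨x, hx, rfl⟩).trans_lt hw'
      by_cases hmem : ∃ v < u, τ v = w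
      · obtain ⟨v, hv, hvw⟩ := hmem
        refine ⟨y.toFun w, tendsto_const_nhds.congr' ?_⟩
        filter_upwards [Ioo_mem_nhdsLT hv] with x hx
        rw [le_antisymm (hw.1 ⟨x, hx.2, rfl⟩) (hvw ▸ hmono hx.1.le)]
      · obtain ⟨z, hz⟩ := y.left_limit w
        refine ⟨z, hz.comp (tendsto_nhdsWithin_iff.2 ⟨hconv, ?_⟩)⟩
        filter_upwards [self_mem_nhdsWithin] with x hx
        exact lt_of_le_of_ne (hw.1 ⟨x, hx, rfl⟩) fun h => hmem ⟨x, hx, h⟩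
    · refine ⟨y.toFun (τ u), ?_⟩
      have : 𝓝[<] u = ⊥ := by
        rw [not_nonempty_iff_eq_empty.1 hne, nhdsWithin_empty]
      rw [this]
      exact tendsto_bot

/-- The right-continuous inverse `v ↦ inf {u ∈ [0, 1] | F u > v} ∧ 1`. -/
def rightInverse (F : unitInterval → ℝ) (v : ℝ) : unitInterval := sInf {u | v < F u}

theorem rightInverse_mono (F : unitInterval → ℝ) : Monotone (rightInverse F) :=
  fun _ _ h => sInf_le_sInf fun _ hu => lt_of_le_of_lt h hu

theorem rightInverse_right_continuous (F : unitInterval → ℝ) (v : ℝ) :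
    ContinuousWithinAt (rightInverse F) (Ici v) v := by
  refine tendsto_order.2 ⟨fun w hw => ?_, fun w hw => ?_⟩
  · filter_upwards [self_mem_nhdsWithin] with x hx using hw.trans_le (rightInverse_mono F hx)
  · obtain ⟨u, hu, huw⟩ := sInf_lt_iff.1 (show sInf {u : unitInterval | v < F u} < w from hw)
    filter_upwards [nhdsWithin_le_nhds (Iio_mem_nhds (show v < F u from hu))] with x hx
    exact lt_of_le_of_lt (sInf_le (a := u) (s := {u : unitInterval | x < F u}) hx) huw

/-- The right-continuous inverse of `F` as a time change from `[a, b]` to `[0, 1]`. -/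
def inverseTime (F : unitInterval → ℝ) (a b : ℝ) (v : Icc a b) : unitInterval := rightInverse F v

theorem inverseTime_mono (F : unitInterval → ℝ) (a b : ℝ) : Monotone (inverseTime F a b) :=
  fun _ _ h => rightInverse_mono F h

theorem inverseTime_right_continuous (F : unitInterval → ℝ) (a b : ℝ) (v : Icc a b) :
    ContinuousWithinAt (inverseTime F a b) (Ici v) v :=
  (rightInverse_right_continuous F v).comp continuous_subtype_val.continuousWithinAt
    fun _ h => h

/-- The path `u ↦ y_{r_u}` on `[t-, T]`, where `r` is the right-continuous inverse of `r̂`. -/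
def originalPath {t T : ℝ} {E : Type*} [TopologicalSpace E] (rhat : C(unitInterval, Icc t T))
    (y : CadlagPath 0 1 E) : CadlagPath t T E :=
  y.timeChange (inverseTime (fun u => rhat u) t T) (inverseTime_mono _ _ _)
    (inverseTime_right_continuous _ _ _)

/-- The space `C([0, 1]; ℝᵈ × ℝˡ × [0, 1])` of the paths `(X̄, ξ̄, s̄)`. -/
abbrev BarPath (d l : ℕ) : Type := C(unitInterval, Vec d × Vec l × unitInterval)

/-- The component `X̄`. -/
def BarPath.X {d l : ℕ} (z : BarPath d l) (u : unitInterval) : Vec d := (z u).1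

/-- The component `ξ̄`. -/
def BarPath.ξ {d l : ℕ} (z : BarPath d l) (u : unitInterval) : Vec l := (z u).2.1

/-- The component `s̄`. -/
def BarPath.s {d l : ℕ} (z : BarPath d l) (u : unitInterval) : unitInterval := (z u).2.2

/-- The right-continuous inverse of the component `s̄`. -/
def BarPath.sInv {d l : ℕ} (z : BarPath d l) (u : unitInterval) : unitInterval :=
  inverseTime (fun v => z.s v) 0 1 u

/-- The first-layer path `u ↦ (X̄_{s_u}, ξ̄_{s_u})` on `[0-, 1]`, with value `(X̄_0, ξ̄_0)` at
time `0-`. -/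
def BarPath.firstLayer {d l : ℕ} (z : BarPath d l) : CadlagPath 0 1 (StateControl d l) :=
  CadlagPath.timeChange
    { pre := (z.X 0, z.ξ 0)
      toFun := fun u => (z.X u, z.ξ u)
      right_continuous := fun u => by
        unfold BarPath.X BarPath.ξ
        exact Continuous.continuousWithinAt (by fun_prop)
      left_limit := fun u => ⟨(z.X u, z.ξ u), by
        unfold BarPath.X BarPath.ξ
        exact (Continuous.tendsto (f := fun v => ((z v).1, (z v).2.1)) (by fun_prop) u).mono_left
          nhdsWithin_le_nhds⟩ }
    (inverseTime (fun v => z.s v) 0 1) (inverseTime_mono _ _ _)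
    (inverseTime_right_continuous _ _ _)

/-- A path with values in `ℝˡ` is non-decreasing: all of its components are. -/
def IsNondecreasing {A : Type*} [Preorder A] {l : ℕ} (ξ : A → Vec l) : Prop :=
  ∀ j, Monotone fun u => ξ u j

/-- A càdlàg control path is non-decreasing on `[a-, b]`. -/
def IsNondecreasingControl {d l : ℕ} {a b : ℝ} (y : CadlagPath a b (StateControl d l)) : Prop :=
  IsNondecreasing (fun u => (y.toFun u).2) ∧ ∀ j u, y.pre.2 j ≤ (y.toFun u).2 j

/-! ### Integrals along paths -/

open scoped Classical in
/-- The Lebesgue-Stieltjes integral `∫_{(a, u]} φ(v) dF(v)` with respect to a right-continuous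
non-decreasing function `F` on `[a, b]`. (For other `F` it is set to zero.) -/
def stieltjesIntegral {a b : ℝ} [Fact (a ≤ b)] {V : Type*} [NormedAddCommGroup V]
    [NormedSpace ℝ V] (φ : Icc a b → V) (F : Icc a b → ℝ) (u : Icc a b) : V :=
  if h : Monotone F ∧ ∀ v, ContinuousWithinAt F (Ici v) v then
    ∫ v in Ioc ⊥ u, φ v ∂(StieltjesFunction.mk F h.1 h.2).measure
  else 0

/-- A sequence of finite partitions of `[a, b]` whose mesh tends to zero. -/
structure PartitionSequence (a b : ℝ) [Fact (a ≤ b)] where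
  size : ℕ → ℕ
  point : ℕ → ℕ → Icc a b
  monotone_point : ∀ n, Monotone (point n)
  first : ∀ n, point n 0 = ⊥
  last : ∀ n, point n (size n) = ⊤
  mesh : ∀ ε > 0, ∀ᶠ n in atTop, ∀ k, (point n (k + 1) : ℝ) - point n k < ε

/-- `Z` is the Itô integral `∫_{(a, ·]} H dB` of a càdlàg integrand `H` against a continuous
semimartingale `B` on `[a, b]`: the limit in probability of the left-point Riemann sums, along every
sequence of partitions whose mesh tends to zero. -/
def IsItoIntegral {a b : ℝ} [Fact (a ≤ b)] {Ω : Type*} [MeasurableSpace Ω] {d q : ℕ}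
    (P : Measure Ω) (H : Ω → Icc a b → (Vec q →L[ℝ] Vec d)) (B : Ω → Icc a b → Vec q)
    (Z : Ω → Icc a b → Vec d) : Prop :=
  ∀ (p : PartitionSequence a b) (u : Icc a b),
    TendstoInMeasure P
      (fun n ω => ∑ k ∈ Finset.range (p.size n),
        H ω (p.point n k) (B ω (min (p.point n (k + 1)) u) - B ω (min (p.point n k) u)))
      atTop (fun ω => Z ω u)

/-- The state process `X` and the control `ξ` (with `Y = (X, ξ)`) satisfy
`dX_u = b(ρ_u, μ_u, X_u, ξ_u) dρ_u + σ(ρ_u, μ_u, X_u, ξ_u) dB_u + γ(ρ_u) dξ_u` on `[a, b]`, where `ρ`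
is the clock, `μ` the measure flow, and `B` the Brownian motion run on the clock `ρ`. -/
def SolvesSDE {a b : ℝ} [Fact (a ≤ b)] {Ω : Type*} [MeasurableSpace Ω] {d l q : ℕ}
    (M : Coefficients d l q) (P : Measure Ω) (ρ : Ω → Icc a b → ℝ)
    (μ : Ω → Icc a b → P2 (StateControl d l)) (Y : Ω → Icc a b → StateControl d l)
    (B : Ω → Icc a b → Vec q) : Prop :=
  IsItoIntegral P (fun ω u => M.σ (ρ ω u) (μ ω u) (Y ω u).1 (Y ω u).2) B
    (fun ω u => (Y ω u).1 - (Y ω ⊥).1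
      - stieltjesIntegral (fun v => M.b (ρ ω v) (μ ω v) (Y ω v).1 (Y ω v).2) (ρ ω) u
      - ∑ j, stieltjesIntegral (fun v => M.γ (ρ ω v) (EuclideanSpace.single j 1))
          (fun v => (Y ω v).2 j) u)

/-- `W` is a standard Brownian motion on `[t, T]`, started in zero at time `t`, for the filtration
`σ(W_v : v ≤ u) ∨ 𝒢_u`. -/
structure IsBrownianMotion {t T : ℝ} [Fact (t ≤ T)] {Ω : Type*} [MeasurableSpace Ω] {q : ℕ}
    (P : Measure Ω) (G : Icc t T → MeasurableSpace Ω) (W : Ω → C(Icc t T, Vec q)) : Prop where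
  start : ∀ᵐ ω ∂P, W ω ⊥ = 0
  law : ∀ u v : Icc t T, u ≤ v → P.map (fun ω => WithLp.ofLp (W ω v - W ω u)) =
    Measure.pi fun _ => gaussianReal 0 ((v : ℝ) - u).toNNReal
  indep : ∀ u v : Icc t T, u ≤ v →
    Indep ((⨆ w : Iic u, MeasurableSpace.comap (fun ω => W ω w) inferInstance) ⊔ G u)
      (MeasurableSpace.comap (fun ω => W ω v - W ω u) inferInstance) P

/-- The `σ`-algebra generated by the first component of `ω` on the time interval `[a-, τ]`. -/
@[reducible] def pathHistory {a b : ℝ} {E Ω' : Type*} [TopologicalSpace E] [MeasurableSpace E]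
    (τ : Icc a b) : MeasurableSpace (CadlagPath a b E × Ω') :=
  MeasurableSpace.comap (fun ω => ω.1.pre) inferInstance ⊔
    ⨆ v : Iic τ, MeasurableSpace.comap (fun ω => ω.1.toFun v) inferInstance

/-- `(X, ξ)` jumps at the initial time `a` according to `X_a = X_{a-} + γ(r) (ξ_a - ξ_{a-})`. -/
def InitialJump {a b : ℝ} [Fact (a ≤ b)] {d l q : ℕ} (M : Coefficients d l q) (r : ℝ)
    (y : CadlagPath a b (StateControl d l)) : Prop :=
  (y.toFun ⊥).1 = y.pre.1 + M.γ r ((y.toFun ⊥).2 - y.pre.2)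

/-! ### Admissible controls -/

/-- `P` is a weak solution of `dX = b dt + σ dW + γ dξ` on `[t-, T]`: a law of `((X, ξ), W)` on
`D⁰([t, T]; ℝᵈ × ℝˡ) × C([t, T]; ℝ^q)`. -/
structure IsWeakSolution {d l q : ℕ} (M : Coefficients d l q) (t T : ℝ) [Fact (t ≤ T)]
    (P : Measure (CadlagPath t T (StateControl d l) × C(Icc t T, Vec q))) : Prop where
  isProbabilityMeasure : IsProbabilityMeasure P
  secondMoment : ∫⁻ ω, (ω.1.supNorm ^ 2 + ‖ω.2‖ₑ ^ 2) ∂P < ∞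
  brownian : IsBrownianMotion P (fun u => pathHistory u) (fun ω => ω.2)
  initialJump : ∀ᵐ ω ∂P, InitialJump M t ω.1
  dynamics : ∃ m : Icc t T → P2 (StateControl d l),
    (∀ u, (m u).toMeasure = P.map fun ω => ω.1.toFun u) ∧
    SolvesSDE M P (fun _ u => u) (fun _ u => m u) (fun ω u => ω.1.toFun u) (fun ω u => ω.2 u)

/-- `P` is an admissible control with initial distribution `m₀` at time `t-`, that is
`P ∈ 𝒫(t, m₀)`. -/
structure IsAdmissible {d l : ℕ} (q : ℕ) (M : Coefficients d l q) (t T : ℝ) [Fact (t ≤ T)]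
    (m₀ : P2 (StateControl d l)) (P : Measure (CadlagPath t T (StateControl d l))) : Prop where
  isProbabilityMeasure : IsProbabilityMeasure P
  secondMoment : ∫⁻ y, y.supNorm ^ 2 ∂P < ∞
  initial : P.map CadlagPath.pre = m₀.toMeasure
  nondecreasing : ∀ᵐ y ∂P, IsNondecreasingControl y
  weakSolution : ∃ Q, IsWeakSolution M t T Q ∧ Q.map Prod.fst = P

/-! ### The first layer -/

/-- `(P, r̂)` is a weak solution of the equation
`dX̂_u = b(r̂_u, m̂_u, X̂_u, ξ̂_u) dr̂_u + σ(r̂_u, m̂_u, X̂_u, ξ̂_u) dŴ_{r̂_u} + γ(r̂_u) dξ̂_u`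
on `[0-, 1]`, where `m̂_u` is the law of `(X̂_u, ξ̂_u)`; the Brownian motion lives on `[t, T]` and
its filtration is `ℱ^Ŵ_u ∨ ℱ^{X̂, ξ̂}_{r_u}`, where `r` is the right-continuous inverse of `r̂`. -/
structure IsFirstLayerSolution {d l q : ℕ} (M : Coefficients d l q) (t T : ℝ) [Fact (t ≤ T)]
    (rhat : C(unitInterval, Icc t T))
    (P : Measure (CadlagPath 0 1 (StateControl d l) × C(Icc t T, Vec q))) : Prop where
  isProbabilityMeasure : IsProbabilityMeasure P
  secondMoment : ∫⁻ ω, (ω.1.supNorm ^ 2 + ‖ω.2‖ₑ ^ 2) ∂P < ∞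
  rhat_zero : (rhat 0 : ℝ) = t
  rhat_one : (rhat 1 : ℝ) = T
  rhat_mono : Monotone rhat
  brownian : IsBrownianMotion P
    (fun u => pathHistory (inverseTime (fun v => rhat v) t T u)) (fun ω => ω.2)
  initialJump : ∀ᵐ ω ∂P, InitialJump M (rhat 0) ω.1
  dynamics : ∃ m : unitInterval → P2 (StateControl d l),
    (∀ u, (m u).toMeasure = P.map fun ω => ω.1.toFun u) ∧
    SolvesSDE (a := 0) (b := 1) M P (fun _ u => rhat u) (fun _ u => m u)
      (fun ω u => ω.1.toFun u) (fun ω u => ω.2 (rhat u))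

/-- `(Phat, r̂)` is a `𝒫₂`-parametrisation of the control `P`. -/
structure IsP2Parametrisation {d l : ℕ} (q : ℕ) (M : Coefficients d l q) (t T : ℝ)
    [Fact (t ≤ T)] (P : Measure (CadlagPath t T (StateControl d l)))
    (Phat : Measure (CadlagPath 0 1 (StateControl d l))) (rhat : C(unitInterval, Icc t T)) :
    Prop where
  isProbabilityMeasure : IsProbabilityMeasure Phat
  secondMoment : ∫⁻ y, y.supNorm ^ 2 ∂Phat < ∞
  original : Phat.map (originalPath rhat) = P
  nondecreasing : ∀ᵐ y ∂Phat, IsNondecreasingControl y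
  flow : ∃ m : C(unitInterval, P2 (StateControl d l)),
    (∀ u, (m u).toMeasure = Phat.map fun y => y.toFun u) ∧
    (m 0).toMeasure = Phat.map CadlagPath.pre
  weakSolution : ∃ Q, IsFirstLayerSolution M t T rhat Q ∧ Q.map Prod.fst = Phat

/-! ### The second layer -/

/-- `(P, r̂)` is a weak solution of the equation
`dX̄_u = b(r̂_{s̄_u}, m̂_{s̄_u}, X̄_u, ξ̄_u) dr̂_{s̄_u} + σ(r̂_{s̄_u}, m̂_{s̄_u}, X̄_u, ξ̄_u) dW̄_{r̂_{s̄_u}}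
+ γ(r̂_{s̄_u}) dξ̄_u` on `[0, 1]`, where `m̂_u` is the law of `(X̄_{s_u}, ξ̄_{s_u})`; the Brownian
motion lives on `[t, T]` and its filtration is `ℱ^W̄_u ∨ ℱ^{X̄, ξ̄, s̄}_{s_{r_u}}`, where the second
`σ`-algebra is generated by the process `(X̄, ξ̄, s̄)` stopped at the time `s_{r_u}`. -/
structure IsSecondLayerSolution {d l q : ℕ} (M : Coefficients d l q) (t T : ℝ) [Fact (t ≤ T)]
    (rhat : C(unitInterval, Icc t T)) (P : Measure (BarPath d l × C(Icc t T, Vec q))) : Prop where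
  isProbabilityMeasure : IsProbabilityMeasure P
  secondMoment : HasFiniteSecondMoment P
  rhat_zero : (rhat 0 : ℝ) = t
  rhat_one : (rhat 1 : ℝ) = T
  s_zero : ∀ᵐ ω ∂P, ω.1.s 0 = 0
  s_one : ∀ᵐ ω ∂P, ω.1.s 1 = 1
  rhat_mono : Monotone rhat
  s_mono : ∀ᵐ ω ∂P, Monotone ω.1.s
  brownian : IsBrownianMotion P
    (fun u => ⨆ v : unitInterval, MeasurableSpace.comap
      (fun ω => ω.1 (min v (ω.1.sInv (inverseTime (fun w => rhat w) t T u)))) inferInstance)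
    (fun ω => ω.2)
  dynamics : ∃ m : unitInterval → P2 (StateControl d l),
    (∀ u, (m u).toMeasure = P.map fun ω => (ω.1.X (ω.1.sInv u), ω.1.ξ (ω.1.sInv u))) ∧
    SolvesSDE (a := 0) (b := 1) M P (fun ω u => rhat (ω.1.s u)) (fun ω u => m (ω.1.s u))
      (fun ω u => (ω.1.X u, ω.1.ξ u)) (fun ω u => ω.2 (rhat (ω.1.s u)))

/-- `((m̂, r̂), P̄)` is a two-layer parametrisation of the control `P`. -/
structure IsTwoLayerParametrisation {d l : ℕ} (q : ℕ) (M : Coefficients d l q) (t T : ℝ)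
    [Fact (t ≤ T)] (P : Measure (CadlagPath t T (StateControl d l)))
    (mhat : C(unitInterval, P2 (StateControl d l))) (rhat : C(unitInterval, Icc t T))
    (Pbar : P2 (BarPath d l)) : Prop where
  firstLayer : IsP2Parametrisation q M t T P (Pbar.toMeasure.map BarPath.firstLayer) rhat
  flow : ∀ u, (mhat u).toMeasure =
    Pbar.toMeasure.map fun z => (z.X (z.sInv u), z.ξ (z.sInv u))
  flow_initial : (mhat 0).toMeasure = Pbar.toMeasure.map fun z => (z.X 0, z.ξ 0)
  nondecreasing : ∀ᵐ z ∂Pbar.toMeasure, IsNondecreasing z.ξ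
  weakSolution : ∃ Q, IsSecondLayerSolution M t T rhat Q ∧ Q.map Prod.fst = Pbar.toMeasure

/-- The two-layer parametrisations on `[t, T]`: the tuples `((m̂, r̂), P̄)` that are a two-layer
parametrisation of some admissible control, with some initial distribution. -/
structure TwoLayerParametrisation {d l q : ℕ} (M : Coefficients d l q) (t T : ℝ)
    [Fact (t ≤ T)] where
  mhat : C(unitInterval, P2 (StateControl d l))
  rhat : C(unitInterval, Icc t T)
  Pbar : P2 (BarPath d l)
  parametrises : ∃ (m₀ : P2 (StateControl d l)) (P : Measure (CadlagPath t T (StateControl d l))),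
    IsAdmissible q M t T m₀ P ∧ IsTwoLayerParametrisation q M t T P mhat rhat Pbar

namespace TwoLayerParametrisation

/-- Convergence of two-layer parametrisations: `(m̂ⁿ, r̂ⁿ) → (m̂, r̂)` uniformly on `[0, 1]` (that is,
in the compact-open topology), and `P̄ⁿ → P̄` in `𝒫₂`. -/
def ConvergesTo {d l q : ℕ} {M : Coefficients d l q} {t T : ℝ} [Fact (t ≤ T)]
    (p : ℕ → TwoLayerParametrisation M t T) (p₀ : TwoLayerParametrisation M t T) : Prop :=
  Tendsto (fun n => (p n).mhat.prodMk (p n).rhat) atTop (𝓝 (p₀.mhat.prodMk p₀.rhat)) ∧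
    Tendsto (fun n => (p n).Pbar) atTop (𝓝 p₀.Pbar)

/-- The pathwise reward
`∫₀¹ f(r̂_{s̄_u}, m̂_{s̄_u}, X̄_u, ξ̄_u) dr̂_{s̄_u} + g(m̂_{s̄_1}, X̄_1, ξ̄_1)
- ∫₀¹ c(r̂_{s̄_u}, m̂_{s̄_u}, X̄_u, ξ̄_u) dξ̄_u`. -/
def pathReward {d l q : ℕ} {M : Coefficients d l q} {t T : ℝ} [Fact (t ≤ T)]
    (p : TwoLayerParametrisation M t T) (z : BarPath d l) : ℝ :=
  stieltjesIntegral (a := 0) (b := 1)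
      (fun u => M.f (p.rhat (z.s u)) (p.mhat (z.s u)) (z.X u) (z.ξ u))
      (fun u => p.rhat (z.s u)) 1
    + M.g (p.mhat (z.s 1)) (z.X 1) (z.ξ 1)
    - ∑ j, stieltjesIntegral (a := 0) (b := 1)
      (fun u => M.c (p.rhat (z.s u)) (p.mhat (z.s u)) (z.X u) (z.ξ u) j)
      (fun u => z.ξ u j) 1

/-- The reward `J((m̂, r̂), P̄)`, the expectation of the pathwise reward under `P̄`. -/
def reward {d l q : ℕ} {M : Coefficients d l q} {t T : ℝ} [Fact (t ≤ T)]
    (p : TwoLayerParametrisation M t T) : ℝ :=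
  ∫ z, p.pathReward z ∂p.Pbar.toMeasure

end TwoLayerParametrisation

end

noncomputable section

/-! ### Stieltjes integrals of continuous functions on the unit interval -/

/-! The reward is the integral against `Pbar` of one functional `pathFunctional M a z` of the
parameter `a = (m̂, r̂)` and the path `z = (X̄, ξ̄, s̄)`, and both claims rest on two of its
properties.

It is jointly continuous on the set where `r̂`, `s̄` and `ξ̄` are non-decreasing
(`continuousOn_pathFunctional`). Uniformly close data give uniformly close integrands and
integrators, and a Stieltjes integral is continuous in both as long as the integrators are monotone:
their total variation is then just the increment over `[0, 1]`, so that a single partition serves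
all nearby pairs (`continuousOn_stieltjesIntegral`).

It grows at most quadratically in the sup-distance of `z` from zero, with a constant that is uniform
for `a` near a given parameter (`eventually_abs_pathFunctional_le`). The clock has total mass `T -
t`, which preserves the quadratic growth of `f`; the linear growth of `c` is multiplied by the
variation of `ξ̄`, itself linear in the path because `ξ̄` is monotone.

Integrability follows from the finite second moment of `Pbar`. Convergence follows from a continuous
mapping theorem for integrands of quadratic growth with a moving parameter
(`P2.tendsto_integral_of_continuousOn`). It is proved directly with couplings of small cost: pairs
that are far apart are charged to the quadratic cost, and close pairs are controlled by continuity
outside a set of small weighted mass. -/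

theorem stieltjesIntegral_eq_setIntegral (φ : unitInterval → ℝ) {F : C(unitInterval, ℝ)}
    (hF : Monotone F) :
    ∃ G : StieltjesFunction unitInterval, (∀ u, G u = F u) ∧
      ∀ u : unitInterval, stieltjesIntegral (a := 0) (b := 1) φ F u = ∫ v in Ioc 0 u, φ v ∂G.measure :=
  ⟨⟨F, hF, fun v => F.continuous.continuousWithinAt⟩, fun _ => rfl, fun _ => by
    unfold stieltjesIntegral
    rw [dif_pos ⟨hF, fun v => F.continuous.continuousWithinAt⟩]
    rfl⟩

theorem StieltjesFunction.measureReal_Ioc (G : StieltjesFunction unitInterval)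
    {u v : unitInterval} (h : u ≤ v) : G.measure.real (Ioc u v) = G v - G u := by
  rw [Measure.real, G.measure_Ioc, ENNReal.toReal_ofReal (sub_nonneg.2 (G.mono h))]

theorem abs_stieltjesIntegral_le {φ : unitInterval → ℝ} {F : C(unitInterval, ℝ)}
    (hF : Monotone F) {C : ℝ} (hφ : ∀ u, |φ u| ≤ C) :
    |stieltjesIntegral (a := 0) (b := 1) φ F 1| ≤ C * (F 1 - F 0) := by
  obtain ⟨G, hG, h⟩ := stieltjesIntegral_eq_setIntegral φ hF
  rw [h, ← hG, ← hG, ← G.measureReal_Ioc zero_le_one, ← Real.norm_eq_abs]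
  exact norm_setIntegral_le_of_norm_le_const (measure_lt_top _ _) fun u _ => hφ u

/-- Left-point Riemann sums along a partition on whose intervals the integrand oscillates by at
most `ε`. -/
theorem abs_setIntegral_sub_riemannSum_le (G : StieltjesFunction unitInterval)
    (φ : C(unitInterval, ℝ)) {τ : ℕ → unitInterval} (hτ : Monotone τ) {ε : ℝ}
    (hφ : ∀ i, ∀ v ∈ Ioc (τ i) (τ (i + 1)), |φ v - φ (τ i)| ≤ ε) (n : ℕ) :
    |(∫ v in Ioc (τ 0) (τ n), φ v ∂G.measure) -
      ∑ i ∈ Finset.range n, φ (τ i) * (G (τ (i + 1)) - G (τ i))| ≤ ε * (G (τ n) - G (τ 0)) := by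
  have hint : Integrable φ G.measure :=
    φ.continuous.integrable_of_hasCompactSupport (HasCompactSupport.of_compactSpace _)
  induction n with
  | zero => simp
  | succ n ih =>
    have hle : τ n ≤ τ (n + 1) := hτ n.le_succ
    rw [← Ioc_union_Ioc_eq_Ioc (hτ n.zero_le) hle,
      setIntegral_union (Ioc_disjoint_Ioc_of_le le_rfl) measurableSet_Ioc hint.integrableOn
        hint.integrableOn, Finset.sum_range_succ]
    have hstep : |(∫ v in Ioc (τ n) (τ (n + 1)), φ v ∂G.measure) -
        φ (τ n) * (G (τ (n + 1)) - G (τ n))| ≤ ε * (G (τ (n + 1)) - G (τ n)) := by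
      have h : (∫ v in Ioc (τ n) (τ (n + 1)), (φ v - φ (τ n)) ∂G.measure) =
          (∫ v in Ioc (τ n) (τ (n + 1)), φ v ∂G.measure) -
            φ (τ n) * (G (τ (n + 1)) - G (τ n)) := by
        rw [integral_sub hint.integrableOn (integrable_const _), setIntegral_const,
          G.measureReal_Ioc hle, smul_eq_mul, mul_comm (φ (τ n))]
      rw [← h, ← G.measureReal_Ioc hle, ← Real.norm_eq_abs]
      exact norm_setIntegral_le_of_norm_le_const (measure_lt_top _ _) (hφ n)
    rw [abs_le] at *
    constructor <;> linarith [hstep.1, hstep.2, ih.1, ih.2]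

/-- The Stieltjes integral is jointly continuous in the integrand and the integrator, for uniform
convergence of both. -/
theorem continuousOn_stieltjesIntegral :
    ContinuousOn (fun p : C(unitInterval, ℝ) × C(unitInterval, ℝ) =>
      stieltjesIntegral (a := 0) (b := 1) p.1 p.2 1) {p | Monotone p.2} := by
  rintro ⟨φ, F⟩ hF
  refine Metric.tendsto_nhds.2 fun ε hε => ?_
  -- The extra 1 lets `C` bound the increments of all integrators near `F` too. With `η = ε / (8C)`,
  -- the two Riemann-sum errors of `3ηC` and the error `ε/8` between the sums add up to `7ε/8`.
  set C : ℝ := F 1 - F 0 + 1 with hC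
  have hF01 : F 0 ≤ F 1 := hF zero_le_one
  have hCpos : 0 < C := by linarith
  set η : ℝ := ε / (8 * C) with hη
  have hηpos : 0 < η := by positivity
  have hηC : η * C = ε / 8 := by rw [hη]; field_simp
  obtain ⟨δ, hδ, hunif⟩ := Metric.uniformContinuous_iff.1
    (CompactSpace.uniformContinuous_of_continuous φ.continuous) η hηpos
  obtain ⟨k, hk⟩ := exists_nat_one_div_lt hδ
  -- Projecting onto `[0, 1]` makes the partition a monotone sequence on all of `ℕ`, constant after
  -- index `k + 1`.
  set τ : ℕ → unitInterval := fun i => projIcc 0 1 zero_le_one ((i : ℝ) / (k + 1)) with hτdef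
  have hτ : Monotone τ := fun i j hij => monotone_projIcc _ (by gcongr)
  have hτ0 : τ 0 = 0 := by simp [hτdef]
  have hτ1 : τ (k + 1) = 1 := by
    simp only [hτdef]
    rw [Nat.cast_add, Nat.cast_one, div_self (by positivity)]
    exact projIcc_right (zero_le_one (α := ℝ))
  have hmesh : ∀ i, dist (τ (i + 1)) (τ i) < δ := fun i => by
    have h : dist (τ (i + 1)) (τ i) ≤ dist (((i + 1 : ℕ) : ℝ) / (k + 1)) ((i : ℝ) / (k + 1)) :=
      (LipschitzWith.projIcc (zero_le_one (α := ℝ))).dist_le_mul _ _ |>.trans_eq (by simp)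
    refine h.trans_lt (lt_of_eq_of_lt ?_ hk)
    rw [Real.dist_eq, ← sub_div, Nat.cast_add, Nat.cast_one, add_sub_cancel_left,
      abs_of_pos (by positivity)]
  -- The partition depends on `φ` alone. The oscillation `3η` of a nearby `φ'` consists of `η` for
  -- that of `φ` and `2η` for replacing `φ'` by `φ` at both points.
  have key : ∀ φ' F' : C(unitInterval, ℝ), dist φ' φ ≤ η → Monotone F' → F' 1 - F' 0 ≤ C →
      |stieltjesIntegral (a := 0) (b := 1) φ' F' 1 -
        ∑ i ∈ Finset.range (k + 1), φ' (τ i) * (F' (τ (i + 1)) - F' (τ i))| ≤ 3 * η * C := by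
    intro φ' F' hφ' hF' hCF
    obtain ⟨G, hG, h⟩ := stieltjesIntegral_eq_setIntegral φ' hF'
    have hosc : ∀ i, ∀ v ∈ Ioc (τ i) (τ (i + 1)), |φ' v - φ' (τ i)| ≤ 3 * η := by
      intro i v hv
      have hd : dist v (τ i) < δ := by
        refine lt_of_le_of_lt ?_ (hmesh i)
        rw [Subtype.dist_eq, Subtype.dist_eq, Real.dist_eq, Real.dist_eq]
        have h1 : (τ i : ℝ) ≤ v := hv.1.le
        have h2 : (v : ℝ) ≤ τ (i + 1) := hv.2
        rw [abs_of_nonneg (by linarith), abs_of_nonneg (by linarith)]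
        linarith
      have h1 := (ContinuousMap.dist_apply_le_dist (f := φ') (g := φ) v).trans hφ'
      have h2 := (ContinuousMap.dist_apply_le_dist (f := φ') (g := φ) (τ i)).trans hφ'
      have h3 := (hunif hd).le
      rw [Real.dist_eq, abs_le] at h1 h2 h3
      rw [abs_le]
      constructor <;> linarith [h1.1, h1.2, h2.1, h2.2, h3.1, h3.2]
    have hmain := abs_setIntegral_sub_riemannSum_le G φ' hτ hosc (k + 1)
    simp only [hτ0, hτ1, hG] at hmain
    rw [h]
    refine hmain.trans ?_
    gcongr
  -- For the fixed partition the Riemann sum involves finitely many point evaluations, so it is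
  -- continuous in the pair.
  have hsum : Tendsto (fun p : C(unitInterval, ℝ) × C(unitInterval, ℝ) =>
      ∑ i ∈ Finset.range (k + 1), p.1 (τ i) * (p.2 (τ (i + 1)) - p.2 (τ i)))
      (𝓝[{p | Monotone p.2}] (φ, F))
      (𝓝 (∑ i ∈ Finset.range (k + 1), φ (τ i) * (F (τ (i + 1)) - F (τ i)))) :=
    (Continuous.tendsto (by fun_prop) _).mono_left nhdsWithin_le_nhds
  have hinc : Tendsto (fun p : C(unitInterval, ℝ) × C(unitInterval, ℝ) => p.2 1 - p.2 0)
      (𝓝[{p | Monotone p.2}] (φ, F)) (𝓝 (F 1 - F 0)) :=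
    (Continuous.tendsto (f := fun p : C(unitInterval, ℝ) × C(unitInterval, ℝ) => p.2 1 - p.2 0)
      (by fun_prop) _).mono_left nhdsWithin_le_nhds
  have hfst : Tendsto (fun p : C(unitInterval, ℝ) × C(unitInterval, ℝ) => p.1)
      (𝓝[{p | Monotone p.2}] (φ, F)) (𝓝 φ) :=
    (continuous_fst.tendsto _).mono_left nhdsWithin_le_nhds
  filter_upwards [self_mem_nhdsWithin, Metric.tendsto_nhds.1 hsum (ε / 8) (by positivity),
    hinc.eventually_lt_const (show F 1 - F 0 < C by linarith), Metric.tendsto_nhds.1 hfst η hηpos]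
    with p hmono hp hpC hpφ
  have h1 := key p.1 p.2 hpφ.le hmono hpC.le
  have h2 := key φ F (by simpa using hηpos.le) hF (by linarith)
  rw [Real.dist_eq, abs_lt] at *
  rw [abs_le] at h1 h2
  constructor <;> linarith [h1.1, h1.2, h2.1, h2.2, hp.1, hp.2]

/-! ### Convergence of integrals in the Wasserstein space -/

theorem integrable_of_hasFiniteSecondMoment {E : Type*} [PseudoMetricSpace E]
    [SecondCountableTopology E] [MeasurableSpace E] [BorelSpace E] {μ : Measure E}
    (h : HasFiniteSecondMoment μ) (z₀ : E) : Integrable (fun z => dist z z₀ ^ 2) μ := by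
  refine ⟨(by fun_prop : Measurable fun z : E => dist z z₀ ^ 2).aestronglyMeasurable, ?_⟩
  refine lt_of_le_of_lt (lintegral_mono fun z => ?_) (h z₀)
  rw [Real.enorm_of_nonneg (by positivity), ENNReal.ofReal_pow dist_nonneg, edist_dist]

/-- Continuity on a measurable set of full measure already gives a.e. strong measurability, so
nothing is needed of `Φ` off `D`. -/
theorem integrable_of_abs_le_dist_sq {E : Type*} [PseudoMetricSpace E]
    [SecondCountableTopology E] [MeasurableSpace E] [BorelSpace E] [StandardBorelSpace E]
    (μ : P2 E) {D : Set E} (hD : MeasurableSet D) (hμD : ∀ᵐ z ∂μ.toMeasure, z ∈ D) {Φ : E → ℝ}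
    (hΦ : ContinuousOn Φ D) {z₀ : E} {K : ℝ} (hK : ∀ z ∈ D, |Φ z| ≤ K * (1 + dist z z₀ ^ 2)) :
    Integrable Φ μ.toMeasure := by
  have := μ.isProbabilityMeasure
  have hm : AEStronglyMeasurable Φ μ.toMeasure := by
    have := hΦ.aestronglyMeasurable (μ := μ.toMeasure) hD
    rwa [Measure.restrict_eq_self_of_ae_mem hμD] at this
  refine Integrable.mono' (((integrable_const 1).add
    (integrable_of_hasFiniteSecondMoment μ.secondMoment z₀)).const_mul K) hm ?_
  filter_upwards [hμD] with z hz using hK z hz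

/-- The distance is an infimum over couplings, so a distance below `√η` provides a coupling of
squared cost at most `η`; no optimal coupling is required. -/
theorem P2.eventually_exists_coupling {E : Type*} [PseudoMetricSpace E]
    [SecondCountableTopology E] [MeasurableSpace E] [BorelSpace E] [StandardBorelSpace E]
    {μ : ℕ → P2 E} {μ₀ : P2 E} (hμ : Tendsto μ atTop (𝓝 μ₀)) {η : ℝ} (hη : 0 < η) :
    ∀ᶠ n in atTop, ∃ π : Measure (E × E), IsCoupling (μ n).toMeasure μ₀.toMeasure π ∧
      Integrable (fun p => dist p.1 p.2 ^ 2) π ∧ ∫ p, dist p.1 p.2 ^ 2 ∂π ≤ η := by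
  have hpos : (0 : ℝ≥0∞) < ENNReal.ofReal η ^ (1 / (2 : ℝ)) :=
    ENNReal.rpow_pos (by simpa using hη) ENNReal.ofReal_ne_top
  filter_upwards [EMetric.tendsto_nhds.1 hμ _ hpos] with n hn
  obtain ⟨π, hπ⟩ := iInf_lt_iff.1 (show wasserstein2 (μ n).toMeasure μ₀.toMeasure < _ from hn)
  obtain ⟨hc, hπ⟩ := iInf_lt_iff.1 hπ
  have hlt := (ENNReal.rpow_lt_rpow_iff (by norm_num)).1
    (show (∫⁻ p, edist p.1 p.2 ^ (2 : ℝ) ∂π) ^ (1 / (2 : ℝ)) < _ from hπ)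
  have heq : ∫⁻ p, ‖dist p.1 p.2 ^ 2‖ₑ ∂π = ∫⁻ p, edist p.1 p.2 ^ (2 : ℝ) ∂π := by
    refine lintegral_congr fun p => ?_
    rw [Real.enorm_of_nonneg (by positivity), ENNReal.ofReal_pow dist_nonneg, edist_dist]
    norm_num
  have hm : Measurable fun p : E × E => dist p.1 p.2 ^ 2 := by fun_prop
  refine ⟨π, hc, ⟨hm.aestronglyMeasurable, ?_⟩, ?_⟩
  · rw [HasFiniteIntegral, heq]
    exact hlt.trans ENNReal.ofReal_lt_top
  · have h2 := enorm_integral_le_lintegral_enorm (μ := π) fun p : E × E => dist p.1 p.2 ^ 2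
    rw [heq, Real.enorm_of_nonneg (integral_nonneg fun _ => by positivity)] at h2
    exact (ENNReal.ofReal_le_ofReal_iff hη.le).1 (h2.trans hlt.le)

/-- Extended continuous mapping theorem in the Wasserstein space of order two, for integrands of
quadratic growth that depend on a parameter. -/
theorem P2.tendsto_integral_of_continuousOn {E : Type*} [PseudoMetricSpace E]
    [SecondCountableTopology E] [MeasurableSpace E] [BorelSpace E] [StandardBorelSpace E]
    {A : Type*} [TopologicalSpace A] {S : Set A} {D : Set E} (hD : MeasurableSet D)
    {Φ : A → E → ℝ} (hΦ : ContinuousOn (fun p : A × E => Φ p.1 p.2) (S ×ˢ D))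
    {a : ℕ → A} {a₀ : A} (ha : Tendsto a atTop (𝓝 a₀)) (haS : ∀ n, a n ∈ S) (ha₀ : a₀ ∈ S)
    {μ : ℕ → P2 E} {μ₀ : P2 E} (hμ : Tendsto μ atTop (𝓝 μ₀))
    (hμD : ∀ n, ∀ᵐ z ∂(μ n).toMeasure, z ∈ D) (hμ₀ : ∀ᵐ z ∂μ₀.toMeasure, z ∈ D)
    {z₀ : E} {K : ℝ} (hK : ∀ᶠ b in 𝓝[S] a₀, ∀ z ∈ D, |Φ b z| ≤ K * (1 + dist z z₀ ^ 2)) :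
    Tendsto (fun n => ∫ z, Φ (a n) z ∂(μ n).toMeasure) atTop (𝓝 (∫ z, Φ a₀ z ∂μ₀.toMeasure)) := by
  have := μ₀.isProbabilityMeasure
  wlog hK0 : 0 ≤ K generalizing K
  · refine this (K := |K|) (hK.mono fun b hb z hz => (hb z hz).trans ?_) (abs_nonneg _)
    gcongr
    exact le_abs_self K
  have haS' : Tendsto a atTop (𝓝[S] a₀) := tendsto_nhdsWithin_iff.2 ⟨ha, .of_forall haS⟩
  have hK₀ : ∀ z ∈ D, |Φ a₀ z| ≤ K * (1 + dist z z₀ ^ 2) := hK.self_of_nhdsWithin ha₀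
  have hcont : ∀ b ∈ S, ContinuousOn (Φ b) D := fun b hb =>
    hΦ.comp (f := fun z => (b, z)) (by fun_prop) fun z hz => ⟨hb, hz⟩
  -- Up to the factor `K`, the part of the crude bound on `|Φ (a n) z' - Φ a₀ z|` that depends on
  -- `z` alone: the two growth bounds and `dist z' z₀ ^ 2 ≤ 2 * dist z' z ^ 2 + 2 * dist z z₀ ^ 2`
  -- give `2 + 3 * dist z z₀ ^ 2`.
  set h : E → ℝ := fun z => 2 + 3 * dist z z₀ ^ 2 with hh
  have hint : Integrable h μ₀.toMeasure :=
    (integrable_const _).add ((integrable_of_hasFiniteSecondMoment μ₀.secondMoment z₀).const_mul _)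
  refine Metric.tendsto_atTop'.2 fun ε hε => ?_
  -- the points near which the integrands are not yet uniformly close, and those far from `z₀`
  let B : ℕ → Set E := fun N => {z | ∃ z' ∈ D, ∃ z'' ∈ D, ∃ n ≥ N, z ∈ Metric.ball z' (1 / (N + 1)) ∧
    z ∈ Metric.ball z'' (1 / (N + 1)) ∧ ε / 4 ≤ |Φ (a n) z' - Φ a₀ z''|} ∪ {z | (N : ℝ) < dist z z₀}
  -- Only the balls constrain `z`, which makes `B N` open and hence measurable whatever `Φ` does off
  -- `D`.
  have hBopen : ∀ N, IsOpen (B N) := fun N => by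
    refine IsOpen.union ?_ (isOpen_lt (by fun_prop) (by fun_prop))
    refine isOpen_iff_mem_nhds.2 ?_
    rintro z ⟨z', h1, z'', h2, n, hn, h3, h4, h5⟩
    filter_upwards [Metric.isOpen_ball.mem_nhds h3, Metric.isOpen_ball.mem_nhds h4] with w hw hw'
    exact ⟨z', h1, z'', h2, n, hn, hw, hw', h5⟩
  have hBanti : Antitone B := by
    intro N N' hN
    have hN' : (1 : ℝ) / (N' + 1) ≤ 1 / (N + 1) := by gcongr
    refine union_subset_union ?_ fun z hz => lt_of_le_of_lt (by gcongr) (show (N' : ℝ) < _ from hz)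
    rintro z ⟨z', h1, z'', h2, n, hn, h3, h4, h5⟩
    exact ⟨z', h1, z'', h2, n, hN.trans hn, Metric.ball_subset_ball hN' h3,
      Metric.ball_subset_ball hN' h4, h5⟩
  have hBnull : μ₀.toMeasure (⋂ N, B N) = 0 := by
    refine measure_mono_null (fun z hz => ?_) (ae_iff.1 hμ₀)
    intro hzD
    -- By joint continuity at `(a₀, z)`, both `Φ (a n) z'` and `Φ a₀ z''` are within `ε/8` of `Φ a₀
    -- z` for large `n` and `z'`, `z''` near `z`. Hence a point `z` of `D` leaves `B N` for large
    -- `N`.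
    have hc := hΦ (a₀, z) ⟨ha₀, hzD⟩
    rw [ContinuousWithinAt, nhdsWithin_prod_eq] at hc
    obtain ⟨p, hp, q, hq, hpq⟩ := eventually_prod_iff.1
      (Metric.tendsto_nhds.1 hc (ε / 8) (by positivity))
    obtain ⟨N₁, hN₁⟩ := eventually_atTop.1 (haS'.eventually hp)
    obtain ⟨δ, hδ, hball⟩ := Metric.mem_nhdsWithin_iff.1 hq
    obtain ⟨N₂, hN₂⟩ := exists_nat_one_div_lt hδ
    obtain ⟨N₃, hN₃⟩ := exists_nat_ge (dist z z₀)
    set N := max N₁ (max N₂ N₃)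
    have hδN : (1 : ℝ) / (N + 1) ≤ δ := by
      refine le_trans ?_ hN₂.le
      have : (N₂ : ℝ) ≤ N := by exact_mod_cast (le_max_left _ _).trans (le_max_right _ _)
      gcongr
    rcases mem_iInter.1 hz N with ⟨z', h1, z'', h2, n, hn, h3, h4, h5⟩ | hfar
    · have e1 := hpq (hN₁ n ((le_max_left _ _).trans hn))
        (hball ⟨Metric.ball_subset_ball hδN (Metric.mem_ball_comm.1 h3), h1⟩)
      have e2 := hpq (hp.self_of_nhdsWithin ha₀)
        (hball ⟨Metric.ball_subset_ball hδN (Metric.mem_ball_comm.1 h4), h2⟩)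
      have := dist_triangle_right (Φ (a n) z') (Φ a₀ z'') (Φ a₀ z)
      rw [← Real.dist_eq] at h5
      linarith
    · have : (N₃ : ℝ) ≤ N := by exact_mod_cast (le_max_right _ _).trans (le_max_right _ _)
      have hfar : (N : ℝ) < dist z z₀ := hfar
      linarith
  have hBint : Tendsto (fun N => ∫ z in B N, h z ∂μ₀.toMeasure) atTop (𝓝 0) := by
    have := tendsto_setIntegral_of_antitone (fun N => (hBopen N).measurableSet) hBanti
      ⟨0, hint.integrableOn⟩
    rwa [setIntegral_measure_zero _ hBnull] at this
  obtain ⟨N, hN⟩ := (hBint.eventually_lt_const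
    (show 0 < ε / (4 * (K + 1)) by positivity)).exists
  have hBN : K * ∫ z in B N, h z ∂μ₀.toMeasure ≤ ε / 4 := by
    have h0 : 0 ≤ ∫ z in B N, h z ∂μ₀.toMeasure := integral_nonneg fun z => by
      simp only [hh, Pi.zero_apply]; positivity
    calc K * ∫ z in B N, h z ∂μ₀.toMeasure ≤ (K + 1) * (ε / (4 * (K + 1))) := by
          gcongr; linarith
      _ = ε / 4 := by field_simp
  -- Pairs with `p.2` outside `B N` and distance at least `1 / (N + 1)` satisfy `h p.2 ≤ 2 + 3N²`
  -- and `1 ≤ (N + 1)² * dist p.1 p.2 ^ 2`, so the whole crude bound is at most `L` times the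
  -- squared distance.
  set L : ℝ := K * (2 + (2 + 3 * N ^ 2) * (N + 1) ^ 2) with hL
  have hL0 : 0 ≤ L := by positivity
  have hev := P2.eventually_exists_coupling hμ (show 0 < ε / (4 * (L + 1)) by positivity)
  refine (Filter.eventually_atTop.1 ?_).imp fun n hn m hm => hn m hm.le
  filter_upwards [hev, haS'.eventually hK, eventually_ge_atTop N] with n hcoup hKn hnN
  obtain ⟨π, ⟨hπ₁, hπ₂⟩, hdint, hdle⟩ := hcoup
  have hi₁ : Integrable (Φ (a n)) (π.map Prod.fst) := by
    rw [hπ₁]; exact integrable_of_abs_le_dist_sq _ hD (hμD n) (hcont _ (haS n)) hKn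
  have hi₂ : Integrable (Φ a₀) (π.map Prod.snd) := by
    rw [hπ₂]; exact integrable_of_abs_le_dist_sq _ hD hμ₀ (hcont _ ha₀) hK₀
  have hi₃ : Integrable ((B N).indicator h) (π.map Prod.snd) := by
    rw [hπ₂]; exact hint.indicator (hBopen N).measurableSet
  have hπprob : IsProbabilityMeasure π := by
    have h : IsProbabilityMeasure (π.map Prod.snd) := by rw [hπ₂]; infer_instance
    exact Measure.isProbabilityMeasure_of_map Prod.snd
  have hD₁ : ∀ᵐ p ∂π, p.1 ∈ D := by
    have := hμD n; rw [← hπ₁] at this; exact ae_of_ae_map measurable_fst.aemeasurable this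
  have hD₂ : ∀ᵐ p ∂π, p.2 ∈ D := by
    have := hμ₀; rw [← hπ₂] at this; exact ae_of_ae_map measurable_snd.aemeasurable this
  rw [← hπ₁, ← hπ₂, integral_map measurable_fst.aemeasurable hi₁.1,
    integral_map measurable_snd.aemeasurable hi₂.1, Real.dist_eq]
  have hj₁ := hi₁.comp_measurable measurable_fst
  have hj₂ := hi₂.comp_measurable measurable_snd
  have hj₃ := hi₃.comp_measurable measurable_snd
  simp only [Function.comp_def] at hj₁ hj₂ hj₃
  rw [← integral_sub hj₁ hj₂]
  -- Three cases: on `B N` the crude bound applies; off `B N`, a close pair differs by less than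
  -- `ε/4`, since otherwise the pair itself would witness `p.2 ∈ B N`; a distant pair is absorbed by
  -- `L`.
  have hbound : ∀ᵐ p ∂π, |Φ (a n) p.1 - Φ a₀ p.2| ≤
      ε / 4 + K * (B N).indicator h p.2 + L * dist p.1 p.2 ^ 2 := by
    filter_upwards [hD₁, hD₂] with p hp₁ hp₂
    have hcrude : |Φ (a n) p.1 - Φ a₀ p.2| ≤ K * h p.2 + 2 * K * dist p.1 p.2 ^ 2 := by
      have htri := dist_triangle p.1 p.2 z₀
      have hsq : dist p.1 z₀ ^ 2 ≤ 2 * dist p.1 p.2 ^ 2 + 2 * dist p.2 z₀ ^ 2 := by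
        have : dist p.1 z₀ ^ 2 ≤ (dist p.1 p.2 + dist p.2 z₀) ^ 2 := by gcongr
        nlinarith [sq_nonneg (dist p.1 p.2 - dist p.2 z₀)]
      calc |Φ (a n) p.1 - Φ a₀ p.2| ≤ |Φ (a n) p.1| + |Φ a₀ p.2| := abs_sub _ _
        _ ≤ K * (1 + dist p.1 z₀ ^ 2) + K * (1 + dist p.2 z₀ ^ 2) :=
          add_le_add (hKn _ hp₁) (hK₀ _ hp₂)
        _ ≤ K * (1 + (2 * dist p.1 p.2 ^ 2 + 2 * dist p.2 z₀ ^ 2)) + K * (1 + dist p.2 z₀ ^ 2) := by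
          gcongr
        _ = _ := by simp only [hh]; ring
    have hd0 : 0 ≤ dist p.1 p.2 ^ 2 := by positivity
    have h2L : 2 * K ≤ L := by
      have : 0 ≤ K * ((2 + 3 * (N : ℝ) ^ 2) * (N + 1) ^ 2) := by positivity
      rw [hL]; linarith
    by_cases hpB : p.2 ∈ B N
    · rw [indicator_of_mem hpB]
      nlinarith [mul_le_mul_of_nonneg_right h2L hd0]
    · rw [indicator_of_notMem hpB]
      have hRle : dist p.2 z₀ ≤ N := not_lt.1 fun hlt => hpB (Or.inr hlt)
      by_cases hnear : dist p.1 p.2 < 1 / (N + 1)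
      · have hsmall : |Φ (a n) p.1 - Φ a₀ p.2| < ε / 4 := not_le.1 fun hle =>
          hpB (Or.inl ⟨p.1, hp₁, p.2, hp₂, n, hnN, by rwa [Metric.mem_ball, dist_comm],
            Metric.mem_ball_self (by positivity), hle⟩)
        have : 0 ≤ L * dist p.1 p.2 ^ 2 := by positivity
        linarith
      · have hone : 1 ≤ (N + 1 : ℝ) ^ 2 * dist p.1 p.2 ^ 2 := by
          rw [← mul_pow]
          refine one_le_pow₀ ?_
          have := not_lt.1 hnear
          rwa [div_le_iff₀ (by positivity), mul_comm] at this
        have hh1 : h p.2 ≤ (2 + 3 * N ^ 2) * ((N + 1 : ℝ) ^ 2 * dist p.1 p.2 ^ 2) := by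
          calc h p.2 ≤ (2 + 3 * N ^ 2) * 1 := by
                simp only [hh, mul_one]; gcongr
            _ ≤ _ := by gcongr
        have := mul_le_mul_of_nonneg_left hh1 hK0
        calc |Φ (a n) p.1 - Φ a₀ p.2| ≤ K * h p.2 + 2 * K * dist p.1 p.2 ^ 2 := hcrude
          _ ≤ K * ((2 + 3 * N ^ 2) * ((N + 1 : ℝ) ^ 2 * dist p.1 p.2 ^ 2)) +
              2 * K * dist p.1 p.2 ^ 2 := by linarith
          _ = L * dist p.1 p.2 ^ 2 := by rw [hL]; ring
          _ ≤ _ := by linarith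
  have hLd : L * ∫ p, dist p.1 p.2 ^ 2 ∂π ≤ ε / 4 := by
    calc L * ∫ p, dist p.1 p.2 ^ 2 ∂π ≤ (L + 1) * (ε / (4 * (L + 1))) := by gcongr; linarith
      _ = ε / 4 := by field_simp
  have hindic : ∫ p, (B N).indicator h p.2 ∂π = ∫ z in B N, h z ∂μ₀.toMeasure := by
    rw [← integral_indicator (hBopen N).measurableSet]
    conv_rhs => rw [← hπ₂]
    rw [integral_map measurable_snd.aemeasurable hi₃.1]
  calc |∫ p, (Φ (a n) p.1 - Φ a₀ p.2) ∂π|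
      ≤ ∫ p, |Φ (a n) p.1 - Φ a₀ p.2| ∂π := abs_integral_le_integral_abs
    _ ≤ ∫ p, (ε / 4 + K * (B N).indicator h p.2 + L * dist p.1 p.2 ^ 2) ∂π :=
      integral_mono_ae (hj₁.sub hj₂).abs
        (((integrable_const _).add (hj₃.const_mul K)).add (hdint.const_mul L)) hbound
    _ = ε / 4 + K * (∫ z in B N, h z ∂μ₀.toMeasure) + L * ∫ p, dist p.1 p.2 ^ 2 ∂π := by
      have hsum : Integrable (fun p => ε / 4 + K * (B N).indicator h p.2) π :=
        (integrable_const _).add (hj₃.const_mul K)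
      rw [integral_add hsum (hdint.const_mul L),
        integral_add (integrable_const _) (hj₃.const_mul K), integral_const_mul,
        integral_const_mul, integral_const, ← hindic]
      simp
    _ < ε := by linarith

/-! ### The pathwise reward -/

theorem LocallyUniformContinuousOn.continuousOn {A B : Type*} [UniformSpace A] [UniformSpace B]
    {h : A → B} {D : Set A} (hh : LocallyUniformContinuousOn h D) : ContinuousOn h D := by
  intro p hp
  obtain ⟨U, hU, hc⟩ := hh p hp
  exact (hc.continuousOn p (mem_of_mem_nhdsWithin hp hU)).mono_of_mem_nhdsWithin hU

/-- A bound that holds locally uniformly in `m` holds uniformly along all flows close to a given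
continuous flow. -/
theorem ContinuousMap.eventually_forall_bound {I P : Type*} [TopologicalSpace I] [CompactSpace I]
    [TopologicalSpace P] {β : ℝ → P → Prop} (hmono : ∀ K K', K ≤ K' → ∀ m, β K m → β K' m)
    (hβ : ∀ m₀ : P, ∃ U ∈ 𝓝 m₀, ∃ K, ∀ m ∈ U, β K m) (m₀ : C(I, P)) :
    ∃ K, ∀ᶠ m in 𝓝 m₀, ∀ u, β K (m u) := by
  have hK : ∃ K, ∃ U : Set P, IsOpen U ∧ range m₀ ⊆ U ∧ ∀ m ∈ U, β K m := by
    -- Compactness of the range of the flow reduces finitely many local constants to their maximum.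
    -- The set `U` is kept open so that the flows with values in `U` form a neighbourhood in the
    -- compact-open topology.
    refine (isCompact_range m₀.continuous).induction_on
      (p := fun s => ∃ K, ∃ U : Set P, IsOpen U ∧ s ⊆ U ∧ ∀ m ∈ U, β K m)
      ⟨0, ∅, isOpen_empty, subset_rfl, by simp⟩ ?_ ?_ ?_
    · rintro s t hst ⟨K, U, hU, htU, h⟩
      exact ⟨K, U, hU, hst.trans htU, h⟩
    · rintro s t ⟨K, U, hU, hsU, h⟩ ⟨K', U', hU', htU', h'⟩
      refine ⟨max K K', U ∪ U', hU.union hU', union_subset_union hsU htU', ?_⟩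
      rintro m (hm | hm)
      · exact hmono _ _ (le_max_left _ _) _ (h m hm)
      · exact hmono _ _ (le_max_right _ _) _ (h' m hm)
    · intro m _
      obtain ⟨U, hU, K, h⟩ := hβ m
      exact ⟨interior U, mem_nhdsWithin_of_mem_nhds (interior_mem_nhds.2 hU), K, interior U,
        isOpen_interior, subset_rfl, fun m hm => h m (interior_subset hm)⟩
  obtain ⟨K, U, hU, hsub, h⟩ := hK
  refine ⟨K, ?_⟩
  filter_upwards [ContinuousMap.eventually_mapsTo isCompact_univ hU
    (fun u _ => hsub (mem_range_self u))] with m hm u using h _ (hm (mem_univ u))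

/-- The pathwise reward as a function of the measure flow, the clock and the path. -/
def pathFunctional {d l q : ℕ} (M : Coefficients d l q) {t T : ℝ}
    (a : C(unitInterval, P2 (StateControl d l)) × C(unitInterval, Icc t T)) (z : BarPath d l) : ℝ :=
  stieltjesIntegral (a := 0) (b := 1)
      (fun u => M.f (a.2 (z.s u)) (a.1 (z.s u)) (z.X u) (z.ξ u)) (fun u => a.2 (z.s u)) 1
    + M.g (a.1 (z.s 1)) (z.X 1) (z.ξ 1)
    - ∑ j, stieltjesIntegral (a := 0) (b := 1)
      (fun u => M.c (a.2 (z.s u)) (a.1 (z.s u)) (z.X u) (z.ξ u) j) (fun u => z.ξ u j) 1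

/-- The paths along which the control and the inner clock are non-decreasing. -/
def BarPath.nondecreasing (d l : ℕ) : Set (BarPath d l) :=
  {z | Monotone z.s ∧ IsNondecreasing z.ξ}

/-- Closedness supplies the measurability needed to pass a.s. monotonicity of `s̄` from the weak
solution to its marginal. -/
theorem BarPath.isClosed_setOf_monotone_s (d l : ℕ) :
    IsClosed {z : BarPath d l | Monotone z.s} := by
  simp only [Monotone, ofPred_forall]
  refine isClosed_iInter fun u => isClosed_iInter fun v => isClosed_iInter fun _ => ?_
  unfold BarPath.s
  exact isClosed_le (by fun_prop) (by fun_prop)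

theorem BarPath.isClosed_nondecreasing (d l : ℕ) : IsClosed (BarPath.nondecreasing d l) := by
  refine (BarPath.isClosed_setOf_monotone_s d l).inter
    (show IsClosed {z : BarPath d l | IsNondecreasing z.ξ} from ?_)
  simp only [IsNondecreasing, Monotone, ofPred_forall]
  refine isClosed_iInter fun j => isClosed_iInter fun u => isClosed_iInter fun v =>
    isClosed_iInter fun _ => ?_
  unfold BarPath.ξ
  exact isClosed_le (by fun_prop) (by fun_prop)

/-! ### Joint continuity and quadratic growth of the path functional -/

section Functional

variable {d l q : ℕ} {M : Coefficients d l q} {t T : ℝ}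

/-- The path `u ↦ (r̂_{s̄_u}, m̂_{s̄_u}, X̄_u, ξ̄_u)`. -/
def argumentPath (p : (C(unitInterval, P2 (StateControl d l)) × C(unitInterval, Icc t T)) ×
    BarPath d l) (u : unitInterval) : Icc t T × P2 (StateControl d l) × Vec d × Vec l :=
  (p.1.2 (p.2.s u), p.1.1 (p.2.s u), p.2.X u, p.2.ξ u)

/-- Evaluation of continuous maps on the compact interval is jointly continuous, which also covers
the compositions with `s̄`. Currying then turns this into continuity of `evalAlong` for uniform
convergence. -/
theorem continuous_uncurry_argumentPath :
    Continuous (Function.uncurry (argumentPath (d := d) (l := l) (t := t) (T := T))) := by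
  unfold argumentPath BarPath.s BarPath.X BarPath.ξ Function.uncurry
  fun_prop

/-- A continuous function evaluated along the path `(r̂_{s̄}, m̂_{s̄}, X̄, ξ̄)`, as a continuous
path. -/
def evalAlong {h : Icc t T × P2 (StateControl d l) × Vec d × Vec l → ℝ} (hh : Continuous h)
    (p : (C(unitInterval, P2 (StateControl d l)) × C(unitInterval, Icc t T)) × BarPath d l) :
    C(unitInterval, ℝ) where
  toFun u := h (argumentPath p u)
  continuous_toFun := hh.comp (continuous_uncurry_argumentPath.comp (Continuous.prodMk_right p))

theorem continuous_evalAlong {h : Icc t T × P2 (StateControl d l) × Vec d × Vec l → ℝ}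
    (hh : Continuous h) : Continuous (evalAlong hh) :=
  ContinuousMap.continuous_of_continuous_uncurry _ (hh.comp continuous_uncurry_argumentPath)

/-- The `j`-th component of the control path. -/
def controlComponent (j : Fin l)
    (p : (C(unitInterval, P2 (StateControl d l)) × C(unitInterval, Icc t T)) × BarPath d l) :
    C(unitInterval, ℝ) :=
  evalAlong (h := fun y => y.2.2.2 j) (by fun_prop) p

/-- Clocks take values in `[t, T] ⊆ [0, T]`; with time in this subtype, continuity on a strip
becomes plain continuity. -/
theorem continuous_comp_time {V : Type*} [TopologicalSpace V] (ht : 0 ≤ t)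
    {h : ℝ × P2 (StateControl d l) × Vec d × Vec l → V} (hh : ContinuousOn h (Icc 0 T ×ˢ univ)) :
    Continuous fun y : Icc t T × P2 (StateControl d l) × Vec d × Vec l => h (y.1, y.2) :=
  hh.comp_continuous (by fun_prop) fun y => ⟨⟨ht.trans y.1.2.1, y.1.2.2⟩, mem_univ _⟩

theorem continuousOn_pathFunctional (ht : 0 ≤ t) (hM : StandingAssumptions M T) :
    ContinuousOn (fun p : (C(unitInterval, P2 (StateControl d l)) × C(unitInterval, Icc t T)) ×
      BarPath d l => pathFunctional M p.1 p.2) ({a | Monotone a.2} ×ˢ BarPath.nondecreasing d l) := by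
  have hf := continuous_comp_time ht hM.f_continuous.continuousOn
  have hc := continuous_comp_time ht hM.c_continuous.continuousOn
  have hcj : ∀ j, Continuous fun y : Icc t T × P2 (StateControl d l) × Vec d × Vec l =>
      M.c y.1 y.2.1 y.2.2.1 y.2.2.2 j := fun j => by fun_prop
  have hr : Continuous fun y : Icc t T × P2 (StateControl d l) × Vec d × Vec l => (y.1 : ℝ) := by
    fun_prop
  refine (ContinuousOn.add ?_ ?_).sub (continuousOn_finsetSum _ fun j _ => ?_)
  · refine continuousOn_stieltjesIntegral.comp (f := fun p => (evalAlong hf p, evalAlong hr p))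
      ((continuous_evalAlong hf).prodMk (continuous_evalAlong hr)).continuousOn ?_
    rintro p ⟨hp, hp'⟩ u v huv
    exact hp (hp'.1 huv)
  · refine Continuous.continuousOn ?_
    have h1 : Continuous fun p : (C(unitInterval, P2 (StateControl d l)) ×
        C(unitInterval, Icc t T)) × BarPath d l => (argumentPath p 1).2 :=
      (continuous_uncurry_argumentPath.comp (Continuous.prodMk_left 1)).snd
    exact hM.g_continuous.comp h1
  · refine continuousOn_stieltjesIntegral.comp
      (f := fun p => (evalAlong (hcj j) p, controlComponent j p))
      ((continuous_evalAlong _).prodMk (continuous_evalAlong _)).continuousOn ?_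
    rintro p ⟨hp, hp'⟩ u v huv
    exact hp'.2 j huv

theorem BarPath.norm_X_le (z : BarPath d l) (u : unitInterval) : ‖z.X u‖ ≤ dist z 0 := by
  have h := ContinuousMap.dist_apply_le_dist (f := z) (g := 0) u
  rw [← dist_zero_right]
  exact (le_max_left _ _).trans h

theorem BarPath.norm_ξ_le (z : BarPath d l) (u : unitInterval) : ‖z.ξ u‖ ≤ dist z 0 := by
  have h := ContinuousMap.dist_apply_le_dist (f := z) (g := 0) u
  rw [← dist_zero_right]
  exact ((le_max_left _ _).trans (le_max_right _ _)).trans h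

/-- Each Stieltjes integral is at most the sup of its integrand times the increment of its
integrator. The growth constants are uniform for all flows near `a₀.1`, by compactness of `[0, 1]`.
-/
theorem eventually_abs_pathFunctional_le (ht : 0 ≤ t) (htT : t ≤ T) (hM : StandingAssumptions M T)
    (a₀ : C(unitInterval, P2 (StateControl d l)) × C(unitInterval, Icc t T)) :
    ∃ K : ℝ, ∀ᶠ a in 𝓝[{a | Monotone a.2}] a₀, ∀ z ∈ BarPath.nondecreasing d l,
      |pathFunctional M a z| ≤ K * (1 + dist z 0 ^ 2) := by
  have hr : Continuous fun y : Icc t T × P2 (StateControl d l) × Vec d × Vec l => (y.1 : ℝ) := by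
    fun_prop
  obtain ⟨Kf, hKf⟩ := ContinuousMap.eventually_forall_bound
    (fun K K' hK m h s hs x ξ => (h s hs x ξ).trans (by gcongr))
    (β := fun K m => ∀ s ∈ Icc 0 T, ∀ x ξ, |M.f s m x ξ| ≤ K * (1 + ‖x‖ ^ 2 + ‖ξ‖ ^ 2))
    (fun m₀ => (hM.f_growth m₀).imp fun U ⟨hU, K, h⟩ => ⟨hU, K, fun m hm s hs => h s hs m hm⟩) a₀.1
  obtain ⟨Kg, hKg⟩ := ContinuousMap.eventually_forall_bound
    (fun K K' hK m h x ξ => (h x ξ).trans (by gcongr))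
    (β := fun K m => ∀ x ξ, |M.g m x ξ| ≤ K * (1 + ‖x‖ ^ 2 + ‖ξ‖ ^ 2)) hM.g_growth a₀.1
  obtain ⟨Kc, hKc⟩ := ContinuousMap.eventually_forall_bound
    (fun K K' hK m h s hs x ξ => (h s hs x ξ).trans (by gcongr))
    (β := fun K m => ∀ s ∈ Icc 0 T, ∀ x ξ, ‖M.c s m x ξ‖ ≤ K * (1 + ‖x‖ + ‖ξ‖))
    (fun m₀ => (hM.c_growth m₀).imp fun U ⟨hU, K, h⟩ => ⟨hU, K, fun m hm s hs => h s hs m hm⟩) a₀.1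
  -- The factor 5 covers both `1 + 2ρ² ≤ 5(1 + ρ²)` and, using `2ρ ≤ 1 + ρ²`, `(1 + 2ρ) * 2ρ ≤ 5(1 +
  -- ρ²)`. Absolute values are taken because the growth constants carry no sign.
  refine ⟨5 * (|Kf| * (T - t) + |Kg| + l * |Kc|), eventually_nhdsWithin_iff.2 ?_⟩
  filter_upwards [(continuous_fst.tendsto a₀).eventually hKf,
    (continuous_fst.tendsto a₀).eventually hKg, (continuous_fst.tendsto a₀).eventually hKc]
    with a hf' hg' hc' ha z hz
  set ρ := dist z 0 with hρ
  have hρ0 : 0 ≤ ρ := dist_nonneg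
  have hX := fun u => z.norm_X_le u
  have hξ := fun u => z.norm_ξ_le u
  have htime : ∀ u, (a.2 (z.s u) : ℝ) ∈ Icc 0 T := fun u =>
    ⟨ht.trans (a.2 (z.s u)).2.1, (a.2 (z.s u)).2.2⟩
  have hquad : ∀ K : ℝ, ∀ u,
      K * (1 + ‖z.X u‖ ^ 2 + ‖z.ξ u‖ ^ 2) ≤ |K| * (1 + ρ ^ 2 + ρ ^ 2) := fun K u => by
    gcongr
    · exact le_abs_self K
    · exact hX u
    · exact hξ u
  have h1 : |stieltjesIntegral (a := 0) (b := 1)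
      (fun u => M.f (a.2 (z.s u)) (a.1 (z.s u)) (z.X u) (z.ξ u)) (fun u => a.2 (z.s u)) 1| ≤
      |Kf| * (1 + ρ ^ 2 + ρ ^ 2) * (T - t) := by
    refine (abs_stieltjesIntegral_le (F := evalAlong hr (a, z)) (fun u v huv => ha (hz.1 huv))
      fun u => (hf' (z.s u) _ (htime u) _ _).trans (hquad Kf u)).trans ?_
    gcongr
    · exact (a.2 (z.s 1)).2.2
    · exact (a.2 (z.s 0)).2.1
  have h2 : |M.g (a.1 (z.s 1)) (z.X 1) (z.ξ 1)| ≤ |Kg| * (1 + ρ ^ 2 + ρ ^ 2) :=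
    (hg' (z.s 1) _ _).trans (hquad Kg 1)
  -- The factor `ρ - -ρ` bounds the increment of a component of `ξ̄`, whose values lie in `[-ρ, ρ]`.
  have h3 : ∀ j, |stieltjesIntegral (a := 0) (b := 1)
      (fun u => M.c (a.2 (z.s u)) (a.1 (z.s u)) (z.X u) (z.ξ u) j) (fun u => z.ξ u j) 1| ≤
      |Kc| * (1 + ρ + ρ) * (ρ - -ρ) := fun j => by
    refine (abs_stieltjesIntegral_le (C := |Kc| * (1 + ρ + ρ)) (F := controlComponent j (a, z))
      (fun u v huv => hz.2 j huv) fun u => ?_).trans ?_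
    · refine (PiLp.norm_apply_le (M.c (a.2 (z.s u)) (a.1 (z.s u)) (z.X u) (z.ξ u)) j).trans
        ((hc' (z.s u) _ (htime u) _ _).trans ?_)
      gcongr
      · exact le_abs_self Kc
      · exact hX u
      · exact hξ u
    · have hj : ∀ u, |z.ξ u j| ≤ ρ := fun u => (PiLp.norm_apply_le (z.ξ u) j).trans (hξ u)
      gcongr
      · exact (abs_le.1 (hj 1)).2
      · exact (abs_le.1 (hj 0)).1
  have h4 := (Finset.abs_sum_le_sum_abs _ Finset.univ).trans (Finset.sum_le_sum fun j _ => h3 j)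
  rw [Finset.sum_const, Finset.card_univ, Fintype.card_fin, nsmul_eq_mul] at h4
  have htT' : 0 ≤ T - t := sub_nonneg.2 htT
  calc |pathFunctional M a z| ≤ |Kf| * (1 + ρ ^ 2 + ρ ^ 2) * (T - t) +
        |Kg| * (1 + ρ ^ 2 + ρ ^ 2) + l * (|Kc| * (1 + ρ + ρ) * (ρ - -ρ)) :=
      (abs_sub _ _).trans (add_le_add ((abs_add_le _ _).trans (add_le_add h1 h2)) h4)
    _ = |Kf| * (T - t) * (1 + ρ ^ 2 + ρ ^ 2) + |Kg| * (1 + ρ ^ 2 + ρ ^ 2) +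
        l * |Kc| * ((1 + ρ + ρ) * (ρ - -ρ)) := by ring
    _ ≤ |Kf| * (T - t) * (5 * (1 + ρ ^ 2)) + |Kg| * (5 * (1 + ρ ^ 2)) +
        l * |Kc| * (5 * (1 + ρ ^ 2)) := by
      gcongr ?_ * ?_ + ?_ * ?_ + ?_ * ?_ <;> nlinarith [sq_nonneg (ρ - 1)]
    _ = _ := by ring

end Functional

/-! ### Integrability and continuity of the reward -/

namespace TwoLayerParametrisation

variable {d l q : ℕ} {M : Coefficients d l q} {t T : ℝ} [Fact (t ≤ T)]

theorem rhat_monotone (p : TwoLayerParametrisation M t T) : Monotone p.rhat := by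
  obtain ⟨m₀, P, -, hp⟩ := p.parametrises
  obtain ⟨Q, hQ, -⟩ := hp.firstLayer.weakSolution
  exact hQ.rhat_mono

theorem ae_mem_nondecreasing (p : TwoLayerParametrisation M t T) :
    ∀ᵐ z ∂p.Pbar.toMeasure, z ∈ BarPath.nondecreasing d l := by
  obtain ⟨m₀, P, -, hp⟩ := p.parametrises
  obtain ⟨Q, hQ, hQP⟩ := hp.weakSolution
  have hs : ∀ᵐ z ∂p.Pbar.toMeasure, Monotone z.s := by
    rw [← hQP, ae_map_iff measurable_fst.aemeasurable
      (BarPath.isClosed_setOf_monotone_s d l).measurableSet]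
    exact hQ.s_mono
  filter_upwards [hs, hp.nondecreasing] with z h1 h2 using ⟨h1, h2⟩

theorem integrable_pathReward (ht : 0 ≤ t) (hM : StandingAssumptions M T)
    (p : TwoLayerParametrisation M t T) : Integrable p.pathReward p.Pbar.toMeasure := by
  obtain ⟨K, hK⟩ := eventually_abs_pathFunctional_le ht Fact.out hM (p.mhat, p.rhat)
  exact integrable_of_abs_le_dist_sq p.Pbar (BarPath.isClosed_nondecreasing d l).measurableSet
    p.ae_mem_nondecreasing ((continuousOn_pathFunctional ht hM).comp
      (f := fun z => ((p.mhat, p.rhat), z)) (by fun_prop) fun z hz => ⟨p.rhat_monotone, hz⟩)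
    -- The local bound holds at the base point itself, which lies in the set of monotone clocks.
    (hK.self_of_nhdsWithin p.rhat_monotone)

theorem ConvergesTo.tendsto_reward (ht : 0 ≤ t) (hM : StandingAssumptions M T)
    {p : ℕ → TwoLayerParametrisation M t T} {p₀ : TwoLayerParametrisation M t T}
    (h : ConvergesTo p p₀) : Tendsto (fun n => (p n).reward) atTop (𝓝 p₀.reward) := by
  obtain ⟨K, hK⟩ := eventually_abs_pathFunctional_le ht Fact.out hM (p₀.mhat, p₀.rhat)
  have hm : Tendsto (fun n => (p n).mhat) atTop (𝓝 p₀.mhat) :=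
    ((ContinuousMap.continuous_postcomp ⟨Prod.fst, continuous_fst⟩).tendsto _).comp h.1
  have hr : Tendsto (fun n => (p n).rhat) atTop (𝓝 p₀.rhat) :=
    ((ContinuousMap.continuous_postcomp ⟨Prod.snd, continuous_snd⟩).tendsto _).comp h.1
  -- By definition `pathReward` is `pathFunctional` at the parameter `(mhat, rhat)`, so the rewards
  -- are integrals of the required form.
  exact P2.tendsto_integral_of_continuousOn (a := fun n => ((p n).mhat, (p n).rhat))
    (BarPath.isClosed_nondecreasing d l).measurableSet (continuousOn_pathFunctional ht hM)
    (hm.prodMk_nhds hr) (fun n => (p n).rhat_monotone) p₀.rhat_monotone h.2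
    (fun n => (p n).ae_mem_nondecreasing) p₀.ae_mem_nondecreasing hK

end TwoLayerParametrisation

end

theorem mainTheorem8 {d l q : ℕ} (M : Coefficients d l q) (t T : ℝ) (hT : 0 < T) (ht : 0 ≤ t)
    [Fact (t ≤ T)] (hM : StandingAssumptions M T) :
    (∀ p : TwoLayerParametrisation M t T, Integrable p.pathReward p.Pbar.toMeasure) ∧
    ∀ (p : ℕ → TwoLayerParametrisation M t T) (p₀ : TwoLayerParametrisation M t T),
      TwoLayerParametrisation.ConvergesTo p p₀ →
        Tendsto (fun n => (p n).reward) atTop (𝓝 p₀.reward) :=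
  ⟨fun p => p.integrable_pathReward ht hM, fun _ _ h => h.tendsto_reward ht hM⟩
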